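/- **Setting.** Work on the torus $[0,2\pi]^2$. For $k\in\mathbb Z^2\setminus\{0\}$ let $k^\perp=(-k^{(2)},k^{(1)})$ and $h_k(\xi)=\frac1{2\pi}\frac{k^\perp}{|k|}e^{ik\cdot\xi}$. Let $\mathbb Z^2_+=\{k: k^{(1)}>0\}\cup\{k: k^{(1)}=0,\ k^{(2)}>0\}$. For $r\in\mathbb R$, $$\mathcal H^r=\Big\{v=\sum_{k\ne0}v_kh_k:\ v_{-k}=-\overline{v_k},\ \|v\|_{\mathcal H^r}^2=\sum_{k\neq 0}|k|^{2r}|v_k|^2<\infty\Big\}.$$ The bilinear term $B(u,v)=P[(u\cdot\nabla)v]$ ($P$ the projector onto divergence-free fields) has the Fourier coefficients $$B_k(u,v)=i\sum_{h\ne0,k}\gamma_{h,k}\,u_hv_{k-h},\qquad \gamma_{h,k}=\frac1{2\pi}\frac{(h^\perp\cdot k)\,((k-h)\cdot k)}{|h||k-h||k|},$$ and for rough $z$ one sets $B_k(z,z)=\lim_{N\to\infty}B_k(\Pi_Nz,\Pi_Nz)$, where $\Pi_N$ keeps the modes $|k|\le N$. For $0<H<1$ let $$C_H=\int_0^\infty\!\!\int_0^\infty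 e^{-r-s}\,\tfrac12\big(r^{2H}+s^{2H}-|r-s|^{2H}\big)\,dr\,ds,$$ and let $\mu^H=\mathcal N(0,C_H(-A)^{-2H})$, $A=\Delta$, be the law of the random family $(v_k)_{k\neq0}$ for which $\Re v_k,\Im v_k$ ($k\in\mathbb Z^2_+$) are independent centred Gaussian variables of variance $C_H|k|^{-4H}$ and $v_{-k}=-\overline{v_k}$. **Proposition.** Let $\frac14<H<1$, and let $\rho<4H-3$ if $H<\frac12$ and $\rho<2(H-1)$ if $H\ge\frac12$. Then $B(z,z)$ is well defined for $\mu^H$-a.e. $z$: for $\mu^H$-a.e. $z$ the limit $B_k(z,z)$ exists for every $k$, and for every $k$ it is also the sum of the series $i\sum_{h\neq 0,k}\gamma_{h,k}z_hz_{k-h}$, unconditionally convergent in $L^2(\mu^H)$. Moreover $B(z,z)$ is a measurable function of $z$, $B(z,z)\in\mathcal H^\rho$ for $\mu^H$-a.e. $z$, and for every $m\in\mathbb N$ $$\int\|B(z,z)\|_{\mathcal H^\rho}^{2m}\,\mu^H(dz)<\infty.$$ **Corollary.** With $H,\rho$ as above, let $\Re b_k,\Im b_k$ ($k\in\mathbb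 Z^2_+$) be independent standard two-sided real fractional Brownian motions of Hurst parameter $H$ with almost surely continuous paths, on any probability space, and let $z(t)=\int_{-\infty}^te^{(t-s)A}dw^H(s)$ be the stationary Stokes process, i.e. $z_k(t)=\int_{-\infty}^te^{-|k|^2(t-s)}db_k(s)$ for $k\in\mathbb Z^2_+$ and $z_{-k}(t)=-\overline{z_k(t)}$. The integrals are pathwise: Riemann–Stieltjes integrals over $[-n,t]$, followed by the limit $n\to\infty$ along the integers. Then for every $t\in\mathbb R$ the law of $z(t)$ is $\mu^H$, and for all $T>0$ and all real $m\ge1$, almost surely: the limits defining $B(z(t),z(t))$ exist for a.e. $t\in(0,T)$, and $$B(z,z)\in L^m(0,T;\mathcal H^\rho).$$ -/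

import Mathlib

open MeasureTheory ProbabilityTheory Filter Topology Set
open scoped ENNReal NNReal

noncomputable section

namespace FracStokes

/-! ### Fourier coefficients and the spaces `H^r`

A divergence-free, zero-mean vector field `v = ∑_{k ≠ 0} v_k h_k` on the torus `[0,2π]²`, with
`h_k(ξ) = (2π)⁻¹ (k^⊥ / |k|) exp(i k·ξ)` and `k^⊥ = (-k₂, k₁)`, is identified with the family
`k ↦ v_k`, extended by `v_0 = 0`. -/

/-- Families of complex Fourier coefficients indexed by `ℤ²`. -/
abbrev Coeff : Type := ℤ × ℤ → ℂ

/-- The Euclidean length `|k|`. -/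
def len (k : ℤ × ℤ) : ℝ := Real.sqrt ((k.1 : ℝ) ^ 2 + (k.2 : ℝ) ^ 2)

/-- The half lattice `ℤ²₊`. -/
def halfLattice : Set (ℤ × ℤ) := {k | 0 < k.1 ∨ (k.1 = 0 ∧ 0 < k.2)}

open Classical in
/-- Extension of coefficients given on `ℤ²₊` to `ℤ²` by `v_{-k} = -conj v_k` and `v_0 = 0`. -/
def reflect (w : halfLattice → ℂ) : Coeff := fun k =>
  if h : k ∈ halfLattice then w ⟨k, h⟩
  else if h : -k ∈ halfLattice then -(starRingEnd ℂ) (w ⟨-k, h⟩)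
  else 0

/-- Membership in `H^r`: zero mean, real-valued field, and `∑_{k ≠ 0} |k|^{2r} |v_k|² < ∞`. -/
def MemH (r : ℝ) (v : Coeff) : Prop :=
  v 0 = 0 ∧ (∀ k, v (-k) = -(starRingEnd ℂ) (v k)) ∧
    Summable fun k : {k : ℤ × ℤ // k ≠ 0} => len k ^ (2 * r) * ‖v k‖ ^ 2

/-- The norm of `H^r`, with value `∞` where the defining series diverges. -/
def normH (r : ℝ) (v : Coeff) : ℝ≥0∞ :=
  (∑' k : {k : ℤ × ℤ // k ≠ 0}, ENNReal.ofReal (len k ^ (2 * r) * ‖v k‖ ^ 2)) ^ (1 / 2 : ℝ)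

/-! ### The bilinear term -/

/-- `γ_{h,k} = (1/2π) (h^⊥·k) ((k-h)·k) / (|h| |k-h| |k|)`. -/
def gam (h k : ℤ × ℤ) : ℝ :=
  1 / (2 * Real.pi) *
    (((-h.2 * k.1 + h.1 * k.2 : ℤ) : ℝ) * (((k - h).1 * k.1 + (k - h).2 * k.2 : ℤ) : ℝ)) /
      (len h * len (k - h) * len k)

/-- The `k`-th Fourier coefficient of `B(u,v) = P[(u·∇)v]`:
`B_k(u,v) = i ∑_{h ≠ 0, h ≠ k} γ_{h,k} u_h v_{k-h}`. -/
def bil (u v : Coeff) : Coeff := fun k =>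
  Complex.I * ∑' h : {h : ℤ × ℤ // h ≠ 0 ∧ h ≠ k}, (gam h k : ℂ) * u h * v (k - h)

/-- The Galerkin projection onto the modes `|k| ≤ N`. -/
def galerkin (N : ℕ) (v : Coeff) : Coeff := fun k => if len k ≤ N then v k else 0

/-- `B(z,z)` for rough `z`: coefficientwise limit of `B(Π_N z, Π_N z)` as `N → ∞`. -/
def quadB (z : Coeff) : Coeff := fun k =>
  limUnder atTop fun N : ℕ => bil (galerkin N z) (galerkin N z) k

/-- The limits defining `quadB z` exist. -/
def QuadConverges (z : Coeff) : Prop :=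
  ∀ k, Tendsto (fun N : ℕ => bil (galerkin N z) (galerkin N z) k) atTop (𝓝 (quadB z k))

/-! ### The Gaussian measure `μ^H = N(0, C_H (-A)^{-2H})` -/

/-- `C_H = ∫₀^∞ ∫₀^∞ e^{-r} e^{-s} (r^{2H} + s^{2H} - |r-s|^{2H}) / 2 dr ds`. -/
def constC (H : ℝ) : ℝ :=
  ∫ r in Ioi (0 : ℝ), ∫ s in Ioi (0 : ℝ),
    Real.exp (-r) * Real.exp (-s) * ((r ^ (2 * H) + s ^ (2 * H) - |r - s| ^ (2 * H)) / 2)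

/-- The law of `(Re v_k, Im v_k)`: two independent `N(0, C_H |k|^{-4H})` variables. -/
def modeLaw (H : ℝ) (k : ℤ × ℤ) : Measure (ℝ × ℝ) :=
  (gaussianReal 0 (constC H / len k ^ (4 * H)).toNNReal).prod
    (gaussianReal 0 (constC H / len k ^ (4 * H)).toNNReal)

instance (H : ℝ) (k : ℤ × ℤ) : IsProbabilityMeasure (modeLaw H k) := by
  unfold modeLaw; infer_instance

/-- `μ^H`: independent modes `k ∈ ℤ²₊` with laws `modeLaw H k`, as a measure on coefficients. -/
def muH (H : ℝ) : Measure Coeff :=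
  (Measure.infinitePi fun k : halfLattice => modeLaw H k).map
    fun x => reflect fun k => ⟨(x k).1, (x k).2⟩

/-! ### Fractional Brownian motion and the stationary Stokes process -/

/-- A standard two-sided real fractional Brownian motion with Hurst parameter `H`. -/
structure IsFBM {Ω : Type*} [MeasurableSpace Ω] (H : ℝ) (X : ℝ → Ω → ℝ) (P : Measure Ω) :
    Prop where
  measurable : ∀ t, Measurable (X t)
  gaussian : IsGaussianProcess X P
  centered : ∀ t, ∫ ω, X t ω ∂P = 0
  covariance : ∀ t s, ∫ ω, X t ω * X s ω ∂P =
    (|t| ^ (2 * H) + |s| ^ (2 * H) - |t - s| ^ (2 * H)) / 2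
  continuous : ∀ᵐ ω ∂P, Continuous fun t => X t ω

/-- The data of a cylindrical fractional Brownian motion `w^H = ∑_k b_k h_k`: the real and
imaginary parts of `b_k`, `k ∈ ℤ²₊`, are independent standard real fractional Brownian motions. -/
structure IsCylFBM {Ω : Type*} [MeasurableSpace Ω] (H : ℝ) (b : halfLattice → ℝ → Ω → ℂ)
    (P : Measure Ω) : Prop where
  re : ∀ k, IsFBM H (fun t ω => (b k t ω).re) P
  im : ∀ k, IsFBM H (fun t ω => (b k t ω).im) P
  indep : iIndepFun
    (Sum.elim (fun (k : halfLattice) (ω : Ω) (t : ℝ) => (b k t ω).re)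
      (fun (k : halfLattice) (ω : Ω) (t : ℝ) => (b k t ω).im)) P

/-- `I` is the Riemann–Stieltjes integral `∫_a^c f dg` (for `a ≤ c`): the limit of the tagged sums
as the mesh of the partition tends to `0`. -/
def HasStieltjes (f g : ℝ → ℝ) (a c I : ℝ) : Prop :=
  ∀ ε > 0, ∃ δ > 0, ∀ (n : ℕ) (x ξ : ℕ → ℝ), x 0 = a → x n = c →
    (∀ i < n, x i ≤ ξ i ∧ ξ i ≤ x (i + 1) ∧ x (i + 1) - x i < δ) →
      |∑ i ∈ Finset.range n, f (ξ i) * (g (x (i + 1)) - g (x i)) - I| < ε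

/-- The Riemann–Stieltjes integral `∫_a^c f dg`. -/
def stieltjes (f g : ℝ → ℝ) (a c : ℝ) : ℝ := Classical.epsilon (HasStieltjes f g a c)

/-- The convolution `∫_{-∞}^t e^{-λ(t-s)} dg(s) = lim_{n → ∞} ∫_{-n}^t e^{-λ(t-s)} dg(s)` along
one path `g`. -/
def expConv (lam : ℝ) (g : ℝ → ℝ) (t : ℝ) : ℝ :=
  limUnder atTop fun n : ℕ => stieltjes (fun s => Real.exp (-(lam * (t - s)))) g (-(n : ℝ)) t

/-- The stationary Stokes process `z(t) = ∫_{-∞}^t e^{(t-s)A} dw^H(s)`, with coefficients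
`z_k(t) = ∫_{-∞}^t e^{-|k|²(t-s)} db_k(s)` for `k ∈ ℤ²₊`. -/
def stokes {Ω : Type*} (b : halfLattice → ℝ → Ω → ℂ) (t : ℝ) (ω : Ω) : Coeff :=
  reflect fun k =>
    ⟨expConv (len k ^ 2) (fun s => (b k s ω).re) t, expConv (len k ^ 2) (fun s => (b k s ω).im) t⟩

/-- `u ∈ L^p(0,T; H^r)`. As `H^r` is a separable Hilbert space, strong measurability is
measurability of every coefficient. -/
def MemLpH (p T r : ℝ) (u : ℝ → Coeff) : Prop :=
  (∀ k, AEMeasurable (fun t => u t k) (volume.restrict (Ioo 0 T))) ∧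
    (∀ᵐ t ∂volume.restrict (Ioo 0 T), MemH r (u t)) ∧
      ∫⁻ t in Ioo 0 T, normH r (u t) ^ p < ∞

end FracStokes

end

namespace FracStokes

noncomputable section

/-! ### Lattice sums -/

/-! Everything rests on a variance count. Since |γ_{h,k}| ≤ |k|, the h-th term of B_k(z,z) has
variance at most a constant times |k|² |h|^{-4H} |k-h|^{-4H}. The sum over h is finite exactly
because 8H > 2. With the weight |k|^{2ρ}, the double sum over k and h converges under the two
conditions on ρ; this is `summable_lattice` with a = 4H and s = 2ρ + 2.

To pass from variances to moments, the quadratic sum is split so that no chaos theory is needed. The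
terms with h parallel to k vanish. The remaining h receive four colours such that, within one
colour, all the modes of h and k-h are distinct (`mode_ne_of_colour`). For each colour and each
choice of real or imaginary parts, one has a sum of independent products of two independent
Gaussians. Its exponential moments are explicit, so its 2m-th moment is at most a constant times the
m-th power of the variance (`lintegral_quadSum_le`).

These bounds make the partial sums over finite sets Cauchy in L^{2m} (`exists_lp_limit`), which
gives unconditional convergence. The variance outside the Galerkin truncation is O(N^{-δ}) with δ >
0, so for m large the 2m-th moments of the errors are summable in N and the Galerkin limit exists
almost surely (`quadB_converges`). A weighted Jensen inequality then sums the bounds over k to give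
all moments of the H^ρ norm (`lintegral_tsum_pow_lt_top`).

For the Stokes process, integration by parts turns each pathwise integral into ∫₀^∞ λ e^{-λr} (g(t)
- g(t-r)) dr with λ = |k|². This is a limit of Gaussian sums, hence Gaussian. Fubini and the scaling
of the covariance give its variance C_H λ^{-2H} = C_H |k|^{-4H}, so z(t) has law μ^H at each t
(`IsCylFBM.stokes_law`). As every time marginal is μ^H, Fubini on Ω × (0,T) transfers the static
results to almost every t. -/

lemma len_nonneg (k : ℤ × ℤ) : 0 ≤ len k := Real.sqrt_nonneg _

lemma len_rpow_nonneg (k : ℤ × ℤ) (r : ℝ) : 0 ≤ len k ^ r := Real.rpow_nonneg (len_nonneg k) r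

lemma len_sq (k : ℤ × ℤ) : len k ^ 2 = (k.1 : ℝ) ^ 2 + (k.2 : ℝ) ^ 2 :=
  Real.sq_sqrt (by positivity)

@[simp] lemma len_zero : len 0 = 0 := by simp [len]

@[simp] lemma len_neg (k : ℤ × ℤ) : len (-k) = len k := by simp [len]

lemma len_sub_comm (h k : ℤ × ℤ) : len (h - k) = len (k - h) := by
  rw [← len_neg, neg_sub]

lemma one_le_len {k : ℤ × ℤ} (hk : k ≠ 0) : 1 ≤ len k := by
  have h : (1 : ℤ) ≤ k.1 ^ 2 + k.2 ^ 2 := by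
    by_contra! hlt
    have h1 : k.1 ^ 2 = 0 := by nlinarith [sq_nonneg k.1, sq_nonneg k.2]
    have h2 : k.2 ^ 2 = 0 := by nlinarith [sq_nonneg k.1, sq_nonneg k.2]
    exact hk (Prod.ext (by simpa using h1) (by simpa using h2))
  have h' : (1 : ℝ) ≤ len k ^ 2 := by rw [len_sq]; exact_mod_cast h
  nlinarith [len_nonneg k]

lemma len_pos {k : ℤ × ℤ} (hk : k ≠ 0) : 0 < len k := zero_lt_one.trans_le (one_le_len hk)

lemma abs_dot_le (h k : ℤ × ℤ) :
    |((h.1 * k.1 + h.2 * k.2 : ℤ) : ℝ)| ≤ len h * len k := by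
  refine abs_le_of_sq_le_sq ?_ (mul_nonneg (len_nonneg _) (len_nonneg _))
  rw [mul_pow, len_sq, len_sq]
  push_cast
  nlinarith [sq_nonneg ((h.1 : ℝ) * k.2 - h.2 * k.1)]

lemma abs_perp_le (h k : ℤ × ℤ) :
    |((-h.2 * k.1 + h.1 * k.2 : ℤ) : ℝ)| ≤ len h * len k := by
  refine abs_le_of_sq_le_sq ?_ (mul_nonneg (len_nonneg _) (len_nonneg _))
  rw [mul_pow, len_sq, len_sq]
  push_cast
  nlinarith [sq_nonneg ((h.1 : ℝ) * k.1 + h.2 * k.2)]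

lemma len_add_le (h k : ℤ × ℤ) : len (h + k) ≤ len h + len k := by
  refine abs_le_of_sq_le_sq' ?_ (add_nonneg (len_nonneg _) (len_nonneg _)) |>.2
  have := (le_abs_self _).trans (abs_dot_le h k)
  push_cast at this
  rw [add_sq, len_sq, len_sq, len_sq]
  simp only [Prod.fst_add, Prod.snd_add]
  push_cast
  nlinarith

/-- Cauchy–Schwarz on both scalar products cancels |h| |k-h| |k| and leaves one factor |k|. A
vanishing denominator gives `gam h k = 0`. -/
lemma abs_gam_le (h k : ℤ × ℤ) : |gam h k| ≤ len k := by
  unfold gam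
  rcases eq_or_ne (len h * len (k - h) * len k) 0 with h0 | h0
  · simp [h0, len_nonneg]
  have hpos : 0 < len h * len (k - h) * len k :=
    lt_of_le_of_ne (by have := len_nonneg h; have := len_nonneg k; have := len_nonneg (k - h)
                       positivity) h0.symm
  rw [abs_div, abs_of_pos hpos, div_le_iff₀ hpos, abs_mul, abs_mul]
  have hpi : |1 / (2 * Real.pi)| ≤ 1 := by
    rw [abs_of_pos (by positivity), div_le_one (by positivity)]
    linarith [Real.pi_gt_three]
  have h1 := abs_perp_le h k
  have h2 := abs_dot_le (k - h) k
  have h3 : 0 ≤ len h * len k := mul_nonneg (len_nonneg _) (len_nonneg _)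
  calc _ ≤ 1 * ((len h * len k) * (len (k - h) * len k)) := by gcongr
    _ = _ := by ring

lemma summable_len_rpow {q : ℝ} (hq : 2 < q) : Summable fun k : ℤ × ℤ => len k ^ (-q) := by
  have h := (finTwoArrowEquiv ℤ).symm.summable_iff.mpr
    (EisensteinSeries.summable_one_div_norm_rpow hq)
  refine Summable.of_nonneg_of_le (fun k => Real.rpow_nonneg (len_nonneg k) _) (fun k => ?_) h
  rcases eq_or_ne k 0 with rfl | hk
  · rw [len_zero, Real.zero_rpow (by linarith)]
    exact Real.rpow_nonneg (norm_nonneg _) _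
  have hx : (finTwoArrowEquiv ℤ).symm k ≠ 0 := fun h0 => hk (by
    rw [← (finTwoArrowEquiv ℤ).apply_symm_apply k, h0]; rfl)
  refine Real.rpow_le_rpow_of_nonpos (norm_pos_iff.mpr hx) ?_ (by linarith)
  refine (pi_norm_le_iff_of_nonneg (len_nonneg k)).mpr fun i => ?_
  refine Real.le_sqrt_of_sq_le ?_
  fin_cases i
  · simpa [finTwoArrowEquiv, Int.norm_eq_abs] using sq_nonneg (k.2 : ℝ)
  · simpa [finTwoArrowEquiv, Int.norm_eq_abs] using sq_nonneg (k.1 : ℝ)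

/-- Weighted AM-GM: the left side is the geometric mean of the three pair products, each with
exponent q = a + p/2, with weights 1 - p/q, p/(2q), p/(2q). The condition p ≤ 2a says that the first
weight is nonnegative. Each pair product is summable over (k,h) once q > 2. -/
lemma rpow_triple_le {a p : ℝ} (ha : 0 < a) (hp : 0 ≤ p) (hpa : p ≤ 2 * a) {A B C : ℝ}
    (hA : 0 < A) (hB : 0 < B) (hC : 0 < C) :
    C ^ (-p) * (A ^ (-a) * B ^ (-a)) ≤
      A ^ (-(a + p / 2)) * B ^ (-(a + p / 2)) + C ^ (-(a + p / 2)) * A ^ (-(a + p / 2)) +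
        C ^ (-(a + p / 2)) * B ^ (-(a + p / 2)) := by
  set q := a + p / 2 with hq
  have hq0 : 0 < q := by positivity
  have h1 : 0 ≤ 1 - p / q := by rw [sub_nonneg, div_le_one hq0]; linarith
  have h2 : 0 ≤ p / (2 * q) := by positivity
  have key := Real.geom_mean_le_arith_mean3_weighted (w₁ := 1 - p / q) (w₂ := p / (2 * q))
    (w₃ := p / (2 * q)) (p₁ := A ^ (-q) * B ^ (-q)) (p₂ := C ^ (-q) * A ^ (-q))
    (p₃ := C ^ (-q) * B ^ (-q)) h1 h2 h2 (by positivity) (by positivity) (by positivity)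
    (by field_simp; ring)
  have e : (A ^ (-q) * B ^ (-q)) ^ (1 - p / q) * (C ^ (-q) * A ^ (-q)) ^ (p / (2 * q)) *
      (C ^ (-q) * B ^ (-q)) ^ (p / (2 * q)) = C ^ (-p) * (A ^ (-a) * B ^ (-a)) := by
    rw [Real.mul_rpow (by positivity) (by positivity), Real.mul_rpow (by positivity) (by positivity),
      Real.mul_rpow (by positivity) (by positivity)]
    simp only [← Real.rpow_mul hA.le, ← Real.rpow_mul hB.le, ← Real.rpow_mul hC.le]
    have eA : A ^ (-a) = A ^ (-q * (1 - p / q)) * A ^ (-q * (p / (2 * q))) := by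
      rw [← Real.rpow_add hA]; congr 1; field_simp; rw [hq]; ring
    have eB : B ^ (-a) = B ^ (-q * (1 - p / q)) * B ^ (-q * (p / (2 * q))) := by
      rw [← Real.rpow_add hB]; congr 1; field_simp; rw [hq]; ring
    have eC : C ^ (-p) = C ^ (-q * (p / (2 * q))) * C ^ (-q * (p / (2 * q))) := by
      rw [← Real.rpow_add hC]; congr 1; field_simp; ring
    rw [eA, eB, eC]; ring
  rw [e] at key
  refine key.trans ?_
  have hw : p / (2 * q) ≤ 1 := by rw [div_le_one (by positivity)]; linarith
  have hw1 : 1 - p / q ≤ 1 := by have : 0 ≤ p / q := by positivity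
                                 linarith
  have e1 : (0 : ℝ) ≤ A ^ (-q) * B ^ (-q) := by positivity
  have e2 : (0 : ℝ) ≤ C ^ (-q) * A ^ (-q) := by positivity
  have e3 : (0 : ℝ) ≤ C ^ (-q) * B ^ (-q) := by positivity
  exact add_le_add (add_le_add (mul_le_of_le_one_left e1 hw1) (mul_le_of_le_one_left e2 hw))
    (mul_le_of_le_one_left e3 hw)

/-- For A, B ≥ 1 one has C ≤ A + B ≤ 2AB, so a positive power of C is absorbed by the other two
factors. -/
lemma rpow_pair_le_of_nonneg {a s : ℝ} (hs : 0 ≤ s) {A B C : ℝ}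
    (hA : 1 ≤ A) (hB : 1 ≤ B) (hC : 0 ≤ C) (hABC : C ≤ A + B) :
    C ^ s * (A ^ (-a) * B ^ (-a)) ≤ 2 ^ s * (A ^ (-(a - s)) * B ^ (-(a - s))) := by
  have hA0 : 0 < A := by linarith
  have hB0 : 0 < B := by linarith
  have h1 : C ≤ 2 * (A * B) := by nlinarith
  have h2 : C ^ s ≤ 2 ^ s * (A ^ s * B ^ s) := by
    rw [← Real.mul_rpow hA0.le hB0.le, ← Real.mul_rpow (by norm_num) (by positivity)]
    exact Real.rpow_le_rpow hC h1 hs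
  calc _ ≤ 2 ^ s * (A ^ s * B ^ s) * (A ^ (-a) * B ^ (-a)) := by gcongr
    _ = 2 ^ s * ((A ^ s * A ^ (-a)) * (B ^ s * B ^ (-a))) := by ring
    _ = _ := by
      rw [← Real.rpow_add hA0, ← Real.rpow_add hB0]; ring_nf

/-- The three families of pair sums over `(k, h)` built from `|k|`, `|h|`, `|k - h|`. -/
lemma summable_pairs {q : ℝ} (hq : 2 < q) :
    Summable (fun x : (ℤ × ℤ) × (ℤ × ℤ) => len x.2 ^ (-q) * len (x.1 - x.2) ^ (-q)) ∧
    Summable (fun x : (ℤ × ℤ) × (ℤ × ℤ) => len x.1 ^ (-q) * len x.2 ^ (-q)) ∧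
    Summable (fun x : (ℤ × ℤ) × (ℤ × ℤ) => len x.1 ^ (-q) * len (x.1 - x.2) ^ (-q)) := by
  have h := (summable_len_rpow hq).mul_of_nonneg (summable_len_rpow hq)
    (fun k => Real.rpow_nonneg (len_nonneg k) _) (fun k => Real.rpow_nonneg (len_nonneg k) _)
  have i1 : Function.Injective fun x : (ℤ × ℤ) × (ℤ × ℤ) => (x.2, x.1 - x.2) := by
    intro x y hxy
    obtain ⟨e1, e2⟩ : x.2 = y.2 ∧ x.1 - x.2 = y.1 - y.2 := Prod.ext_iff.mp hxy
    rw [e1] at e2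
    exact Prod.ext (sub_left_injective e2) e1
  have i2 : Function.Injective fun x : (ℤ × ℤ) × (ℤ × ℤ) => (x.1, x.1 - x.2) := by
    intro x y hxy
    obtain ⟨e1, e2⟩ : x.1 = y.1 ∧ x.1 - x.2 = y.1 - y.2 := Prod.ext_iff.mp hxy
    rw [e1] at e2
    exact Prod.ext e1 (sub_right_injective e2)
  refine ⟨?_, h, ?_⟩
  · have := h.comp_injective i1
    simpa only [Function.comp_def] using this
  · have := h.comp_injective i2
    simpa only [Function.comp_def] using this

/-- Convergence of `∑_{k ≠ 0} |k|^s ∑_{h ≠ 0, k} |h|^{-a} |k-h|^{-a}`. -/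
lemma summable_lattice {a s : ℝ} (ha : 1 < a) (h1 : a < 2 → s < 2 * a - 4)
    (h2 : 2 ≤ a → s < a - 2) :
    Summable fun x : (ℤ × ℤ) × (ℤ × ℤ) =>
      if x.1 = 0 then 0 else len x.1 ^ s * (len x.2 ^ (-a) * len (x.1 - x.2) ^ (-a)) := by
  have nn := len_rpow_nonneg
  have h0 : ∀ x : (ℤ × ℤ) × (ℤ × ℤ), 0 ≤
      if x.1 = 0 then 0 else len x.1 ^ s * (len x.2 ^ (-a) * len (x.1 - x.2) ^ (-a)) := by
    intro x; split_ifs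
    · rfl
    · exact mul_nonneg (nn _ _) (mul_nonneg (nn _ _) (nn _ _))
  -- By the `Real.rpow` convention the terms h = 0 and h = k are zero, so h may range over the whole
  -- lattice.
  have hz : (0 : ℝ) ^ (-a) = 0 := Real.zero_rpow (by linarith)
  rcases le_or_gt 0 s with hs | hs
  · have ha2 : 2 ≤ a := by by_contra! hlt; linarith [h1 hlt]
    refine Summable.of_nonneg_of_le h0 (fun x => ?_)
      ((summable_pairs (q := a - s) (by linarith [h2 ha2])).1.mul_left (2 ^ s))
    have hR : 0 ≤ 2 ^ s * (len x.2 ^ (-(a - s)) * len (x.1 - x.2) ^ (-(a - s))) :=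
      mul_nonneg (by positivity) (mul_nonneg (nn _ _) (nn _ _))
    rcases eq_or_ne x.1 0 with e | e
    · rwa [if_pos e]
    rw [if_neg e]
    rcases eq_or_ne x.2 0 with e2 | e2
    · rw [e2] at hR ⊢; rw [len_zero, hz]; simpa using hR
    rcases eq_or_ne (x.1 - x.2) 0 with e3 | e3
    · rw [e3] at hR ⊢; rw [len_zero, hz]; simpa using hR
    refine rpow_pair_le_of_nonneg hs (one_le_len e2) (one_le_len e3) (len_nonneg _) ?_
    simpa using len_add_le x.2 (x.1 - x.2)
  -- The decay |k|^s is weakened to |k|^{-p}; the cap at 2a is what the three-term inequality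
  -- allows, and the exponent a + p/2 still exceeds 2.
  · set p := min (-s) (2 * a) with hp
    have hp0 : 0 ≤ p := le_min (by linarith) (by linarith)
    have hpa : p ≤ 2 * a := min_le_right _ _
    have hq : 2 < a + p / 2 := by
      rcases min_choice (-s) (2 * a) with e | e
      · rw [hp, e]
        rcases lt_or_ge a 2 with h | h
        · linarith [h1 h]
        · linarith [h2 h]
      · rw [hp, e]; linarith
    obtain ⟨s1, s2, s3⟩ := summable_pairs hq
    refine Summable.of_nonneg_of_le h0 (fun x => ?_) ((s1.add s2).add s3)
    have hR : 0 ≤ len x.2 ^ (-(a + p / 2)) * len (x.1 - x.2) ^ (-(a + p / 2)) +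
        len x.1 ^ (-(a + p / 2)) * len x.2 ^ (-(a + p / 2)) +
        len x.1 ^ (-(a + p / 2)) * len (x.1 - x.2) ^ (-(a + p / 2)) :=
      add_nonneg (add_nonneg (mul_nonneg (nn _ _) (nn _ _)) (mul_nonneg (nn _ _) (nn _ _)))
        (mul_nonneg (nn _ _) (nn _ _))
    rcases eq_or_ne x.1 0 with e | e
    · rwa [if_pos e]
    rw [if_neg e]
    rcases eq_or_ne x.2 0 with e2 | e2
    · refine le_trans (le_of_eq ?_) hR; rw [e2, len_zero, hz]; simp
    rcases eq_or_ne (x.1 - x.2) 0 with e3 | e3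
    · refine le_trans (le_of_eq ?_) hR; rw [e3, len_zero, hz]; simp
    refine le_trans ?_ (rpow_triple_le (by linarith) hp0 hpa (len_pos e2) (len_pos e3) (len_pos e))
    gcongr
    · exact mul_nonneg (nn _ _) (nn _ _)
    · exact one_le_len e
    · have := min_le_left (-s) (2 * a); linarith

/-- Convergence of `∑_h |h|^{-b} |k-h|^{-b}`. -/
lemma summable_convolution {b : ℝ} (hb : 1 < b) (k : ℤ × ℤ) :
    Summable fun h : ℤ × ℤ => len h ^ (-b) * len (k - h) ^ (-b) := by
  have h1 := summable_len_rpow (q := 2 * b) (by linarith)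
  have h2 : Summable fun h : ℤ × ℤ => len (k - h) ^ (-(2 * b)) :=
    h1.comp_injective (i := fun h => k - h) fun x y hxy => by simpa using hxy
  refine Summable.of_nonneg_of_le (fun h => mul_nonneg (Real.rpow_nonneg (len_nonneg _) _)
    (Real.rpow_nonneg (len_nonneg _) _)) (fun h => ?_) (h1.add h2)
  have e : ∀ x : ℤ × ℤ, len x ^ (-(2 * b)) = (len x ^ (-b)) ^ 2 := fun x => by
    rw [← Real.rpow_natCast, ← Real.rpow_mul (len_nonneg x)]; congr 1; push_cast; ring
  rw [e, e]
  nlinarith [sq_nonneg (len h ^ (-b) - len (k - h) ^ (-b)), sq_nonneg (len h ^ (-b)),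
    sq_nonneg (len (k - h) ^ (-b))]

/-! ### Moments of sums of independent products of Gaussian variables -/

section Moments

variable {Ω ι κ : Type*} [MeasurableSpace Ω] {μ : Measure Ω}

/-- Regrouping of an independent family into independent blocks; it is applied to blocks of two
Gaussians. -/
lemma iIndepFun_curry {β : Type*} [MeasurableSpace β] {X : ι × κ → Ω → β}
    (mX : ∀ p, Measurable (X p)) (h : iIndepFun X μ) :
    iIndepFun (fun i ω j => X (i, j) ω) μ := by
  have := h.isProbabilityMeasure
  have hp : ∀ p, IsProbabilityMeasure (μ.map (X p)) :=
    fun p => Measure.isProbabilityMeasure_map (mX p).aemeasurable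
  have e : (fun ω i j => X (i, j) ω) =
      MeasurableEquiv.curry ι κ β ∘ fun ω p => X p ω := rfl
  rw [iIndepFun_iff_map_fun_eq_infinitePi_map (by fun_prop), e,
    ← Measure.map_map (by fun_prop) (by fun_prop), h.map_fun_eq_infinitePi_map mX,
    Measure.infinitePi_map_curry fun i j => μ.map (X (i, j))]
  congr 1
  ext1 i
  have hi : iIndepFun (fun j => X (i, j)) μ :=
    h.precomp (g := fun j => (i, j)) fun a b hab => (Prod.mk.inj hab).2
  exact (hi.map_fun_eq_infinitePi_map fun j => mX _).symm

/-- The integral equals (1 - 2bv)^{-1/2}. With x = 2bv ≤ 1/2, one has 1 ≤ (1 + 2x)(1 - x) ≤ e^{2x}(1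
- x), which gives the bound. -/
lemma gaussianReal_exp_sq {b : ℝ} {v : ℝ≥0} (hb : 0 ≤ b) (hbv : 4 * b * v ≤ 1) :
    Integrable (fun x => Real.exp (b * x ^ 2)) (gaussianReal 0 v) ∧
      ∫ x, Real.exp (b * x ^ 2) ∂gaussianReal 0 v ≤ Real.exp (2 * b * v) := by
  rcases eq_or_ne v 0 with rfl | hv
  · rw [gaussianReal_zero_var]
    exact ⟨integrable_dirac (by simp), by simp⟩
  have hv0 : (0 : ℝ) < v := NNReal.coe_pos.mpr (pos_iff_ne_zero.mpr hv)
  set c : ℝ := 1 / (2 * v) - b with hc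
  have hc0 : 0 < c := by
    rw [hc, sub_pos, lt_div_iff₀ (by positivity)]; linarith
  have e : ∀ x, gaussianPDFReal 0 v x • Real.exp (b * x ^ 2) =
      (√(2 * Real.pi * v))⁻¹ * Real.exp (-c * x ^ 2) := fun x => by
    rw [gaussianPDFReal, smul_eq_mul, mul_assoc, ← Real.exp_add, hc]
    congr 2
    field_simp
    ring
  constructor
  · rw [gaussianReal_of_var_ne_zero _ hv, integrable_withDensity_iff_integrable_smul'
      (measurable_gaussianPDF _ _) (ae_of_all _ fun _ => gaussianPDF_lt_top)]
    simp only [toReal_gaussianPDF, e]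
    exact (integrable_exp_neg_mul_sq hc0).const_mul _
  · rw [integral_gaussianReal_eq_integral_smul hv]
    simp only [e]
    rw [integral_const_mul, integral_gaussian, ← Real.sqrt_inv, ← Real.sqrt_mul (by positivity)]
    refine Real.sqrt_le_iff.mpr ⟨(Real.exp_pos _).le, ?_⟩
    have h1 : (2 * Real.pi * v)⁻¹ * (Real.pi / c) = 1 / (1 - 2 * b * v) := by
      have h2 : 1 - 2 * b * v = 2 * v * c := by rw [hc]; field_simp
      rw [h2]; field_simp
    have h3 : 0 < 1 - 2 * b * v := by nlinarith [mul_nonneg hb hv0.le]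
    rw [h1, div_le_iff₀ h3, ← Real.exp_nat_mul]
    have h4 := Real.add_one_le_exp (((2 : ℕ) : ℝ) * (2 * b * v))
    have h5 : 0 ≤ b * v := mul_nonneg hb hv0.le
    push_cast at h4 ⊢
    nlinarith [mul_le_mul_of_nonneg_right h4 h3.le]

/-- Integrating Y out first leaves E exp(w t² X² / 2), to which the previous bound applies with b =
w t² / 2. -/
lemma gaussian_mul_mgf {X Y : Ω → ℝ} {v w : ℝ≥0} (hX : Measurable X) (hY : Measurable Y)
    (hXY : IndepFun X Y μ) (lX : μ.map X = gaussianReal 0 v) (lY : μ.map Y = gaussianReal 0 w)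
    [IsProbabilityMeasure μ] {t : ℝ} (ht : 2 * (t ^ 2 * (v * w)) ≤ 1) :
    Integrable (fun ω => Real.exp (t * (X ω * Y ω))) μ ∧
      mgf (fun ω => X ω * Y ω) μ t ≤ Real.exp (t ^ 2 * (v * w)) := by
  have hlaw : μ.map (fun ω => (X ω, Y ω)) = (gaussianReal 0 v).prod (gaussianReal 0 w) := by
    rw [(indepFun_iff_map_prod_eq_prod_map_map hX.aemeasurable hY.aemeasurable).mp hXY, lX, lY]
  have inner : ∀ x : ℝ, ∫ y, Real.exp (t * (x * y)) ∂gaussianReal 0 w =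
      Real.exp ((w * t ^ 2 / 2) * x ^ 2) := fun x => by
    have := congrFun (mgf_id_gaussianReal (μ := 0) (v := w)) (t * x)
    simp only [mgf, id] at this
    simp only [← mul_assoc, this]
    congr 1; ring
  obtain ⟨g1, g2⟩ := gaussianReal_exp_sq (b := w * t ^ 2 / 2) (v := v) (by positivity)
    (by linarith)
  have hint : Integrable (fun p : ℝ × ℝ => Real.exp (t * (p.1 * p.2)))
      ((gaussianReal 0 v).prod (gaussianReal 0 w)) := by
    rw [integrable_prod_iff (by fun_prop)]
    refine ⟨ae_of_all _ fun x => ?_, ?_⟩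
    · simpa only [← mul_assoc] using integrable_exp_mul_gaussianReal (t * x)
    · simpa only [Real.norm_eq_abs, Real.abs_exp, inner] using g1
  constructor
  · rw [← hlaw] at hint
    exact hint.comp_measurable (f := fun ω => (X ω, Y ω)) (by fun_prop)
  · have : mgf (fun ω => X ω * Y ω) μ t =
        ∫ p : ℝ × ℝ, Real.exp (t * (p.1 * p.2)) ∂(μ.map fun ω => (X ω, Y ω)) := by
      rw [integral_map (by fun_prop) (by fun_prop)]; rfl
    rw [this, hlaw, integral_prod _ hint]
    simp only [inner]
    refine g2.trans (le_of_eq ?_)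
    congr 1; ring

lemma pow_le_factorial_mul_exp {t x : ℝ} (ht : 0 < t) (m : ℕ) :
    x ^ (2 * m) ≤ (2 * m).factorial / t ^ (2 * m) * (Real.exp (t * x) + Real.exp (-t * x)) := by
  have h1 := Real.pow_div_factorial_le_exp (|t * x|) (abs_nonneg _) (2 * m)
  have h2 : Real.exp |t * x| ≤ Real.exp (t * x) + Real.exp (-t * x) := by
    rcases abs_cases (t * x) with ⟨h, -⟩ | ⟨h, -⟩ <;> rw [h]
    · linarith [Real.exp_pos (-t * x)]
    · rw [neg_mul]; linarith [Real.exp_pos (t * x)]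
  have h3 : |t * x| ^ (2 * m) = t ^ (2 * m) * x ^ (2 * m) := by
    rw [pow_mul, sq_abs, ← pow_mul, mul_pow]
  rw [h3, div_le_iff₀ (by positivity)] at h1
  rw [div_mul_eq_mul_div, le_div_iff₀ (by positivity)]
  nlinarith [mul_le_mul_of_nonneg_left h2 (Nat.cast_nonneg (α := ℝ) (2 * m).factorial)]

/-- Evaluation at t = ±(2W)^{-1/2}, the largest admissible value: both exponential moments are at
most e^{1/2} ≤ 2, and x^{2m} is controlled by (2m)! t^{-2m} (e^{tx} + e^{-tx}). -/
lemma lintegral_pow_le_of_mgf_le [IsProbabilityMeasure μ] {S : Ω → ℝ} {W : ℝ} (hW : 0 < W)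
    (hint : ∀ t : ℝ, 2 * (t ^ 2 * W) ≤ 1 → Integrable (fun ω => Real.exp (t * S ω)) μ)
    (hmgf : ∀ t : ℝ, 2 * (t ^ 2 * W) ≤ 1 → mgf S μ t ≤ Real.exp (t ^ 2 * W)) (m : ℕ) :
    ∫⁻ ω, ENNReal.ofReal (S ω ^ (2 * m)) ∂μ ≤
      ENNReal.ofReal (4 * (2 * m).factorial * (2 * W) ^ m) := by
  set t : ℝ := √(1 / (2 * W)) with ht
  have ht0 : 0 < t := Real.sqrt_pos.mpr (by positivity)
  have htsq : t ^ 2 = 1 / (2 * W) := Real.sq_sqrt (by positivity)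
  have hW1 : t ^ 2 * W = 1 / 2 := by rw [htsq]; field_simp
  have i1 := hint t (by rw [hW1]; norm_num)
  have i2 := hint (-t) (by rw [neg_sq, hW1]; norm_num)
  have m1 := hmgf t (by rw [hW1]; norm_num)
  have m2 := hmgf (-t) (by rw [neg_sq, hW1]; norm_num)
  rw [neg_sq, hW1] at m2
  rw [hW1] at m1
  have he : Real.exp (1 / 2) ≤ 2 := by
    have h := Real.exp_one_lt_d9
    have h2 : Real.exp (1 / 2) ^ 2 = Real.exp 1 := by rw [← Real.exp_nat_mul]; norm_num
    nlinarith [Real.exp_pos (1 / 2 : ℝ)]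
  have i3 := (i1.add i2).const_mul ((2 * m).factorial / t ^ (2 * m) : ℝ)
  simp only [Pi.add_apply] at i3
  calc ∫⁻ ω, ENNReal.ofReal (S ω ^ (2 * m)) ∂μ
      ≤ ∫⁻ ω, ENNReal.ofReal ((2 * m).factorial / t ^ (2 * m) *
          (Real.exp (t * S ω) + Real.exp (-t * S ω))) ∂μ :=
        lintegral_mono fun ω => ENNReal.ofReal_le_ofReal (pow_le_factorial_mul_exp ht0 m)
    _ = ENNReal.ofReal ((2 * m).factorial / t ^ (2 * m) * (mgf S μ t + mgf S μ (-t))) := by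
        rw [mgf, mgf, ← integral_add i1 i2, ← integral_const_mul,
          ofReal_integral_eq_lintegral_ofReal i3 (ae_of_all _ fun ω => by
            positivity)]
    _ ≤ _ := by
        refine ENNReal.ofReal_le_ofReal ?_
        have e : ((2 * m).factorial : ℝ) / t ^ (2 * m) = (2 * m).factorial * (2 * W) ^ m := by
          rw [pow_mul, htsq, div_eq_mul_inv, ← inv_pow, one_div, inv_inv]
        rw [e]
        have : mgf S μ t + mgf S μ (-t) ≤ 4 := by linarith
        calc _ ≤ ((2 * m).factorial : ℝ) * (2 * W) ^ m * 4 := by gcongr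
          _ = _ := by ring

/-- When no variable occurs twice, the summands are independent, so the moment generating functions
multiply and the exponents t² c² v w add up to at most t² W. -/
lemma lintegral_sum_mul_pow_le [IsProbabilityMeasure μ] {X : ι → Ω → ℝ} {v : ι → ℝ≥0}
    (mX : ∀ i, Measurable (X i)) (hX : iIndepFun X μ)
    (lX : ∀ i, μ.map (X i) = gaussianReal 0 (v i)) (F : Finset κ) (c : κ → ℝ) (u w : κ → ι)
    (hu : Set.InjOn u F) (hw : Set.InjOn w F) (huw : ∀ g ∈ F, ∀ g' ∈ F, u g ≠ w g')
    {W : ℝ} (hW : 0 < W) (hV : ∑ g ∈ F, c g ^ 2 * (v (u g) * v (w g)) ≤ W) (m : ℕ) :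
    ∫⁻ ω, ENNReal.ofReal ((∑ g ∈ F, c g * (X (u g) ω * X (w g) ω)) ^ (2 * m)) ∂μ ≤
      ENNReal.ofReal (4 * (2 * m).factorial * (2 * W) ^ m) := by
  -- The hypotheses on `u` and `w` say exactly that this enumeration of all factors is injective.
  let idx : F × Fin 2 → ι := fun p => if p.2 = 0 then u p.1 else w p.1
  have idx_inj : Function.Injective idx := by
    rintro ⟨g, i⟩ ⟨g', j⟩ h
    fin_cases i <;> fin_cases j <;> simp only [idx] at h <;> simp at h
    · rw [Subtype.ext (hu g.2 g'.2 h)]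
    · exact absurd h (huw _ g.2 _ g'.2)
    · exact absurd h.symm (huw _ g'.2 _ g.2)
    · rw [Subtype.ext (hw g.2 g'.2 h)]
  have hpair := iIndepFun_curry (fun p => mX (idx p)) (hX.precomp idx_inj)
  let Z : F → Ω → ℝ := fun g ω => c g * (X (u g) ω * X (w g) ω)
  have hZ : iIndepFun Z μ :=
    hpair.comp (fun g f => c g * (f 0 * f 1)) fun g => by fun_prop
  have mZ : ∀ g, Measurable (Z g) := fun g => by fun_prop
  have hsum : (fun ω => ∑ g ∈ F, c g * (X (u g) ω * X (w g) ω)) = ∑ g, Z g := by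
    ext ω
    rw [Finset.sum_apply, ← Finset.sum_coe_sort]
  have hterm : ∀ t : ℝ, 2 * (t ^ 2 * W) ≤ 1 → ∀ g : F,
      Integrable (fun ω => Real.exp (t * Z g ω)) μ ∧
        mgf (Z g) μ t ≤ Real.exp (t ^ 2 * (c g ^ 2 * (v (u g) * v (w g)))) := by
    intro t ht g
    have hle : c g ^ 2 * (v (u g) * v (w g)) ≤ W := le_trans
      (Finset.single_le_sum (f := fun g => c g ^ 2 * ((v (u g) : ℝ) * v (w g)))
        (fun _ _ => by positivity) g.2) hV
    have := gaussian_mul_mgf (mX (u g)) (mX (w g)) (hX.indepFun (huw g g.2 g g.2)) (lX _) (lX _)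
      (t := t * c g) (by nlinarith [mul_le_mul_of_nonneg_left hle (sq_nonneg t)])
    refine ⟨?_, ?_⟩
    · refine this.1.congr (ae_of_all _ fun ω => ?_)
      simp only [Z]; ring_nf
    · refine le_trans (le_of_eq ?_) (this.2.trans (le_of_eq (by ring_nf)))
      simp only [mgf, Z]; ring_nf
  have hpow : ∀ ω, ∑ g ∈ F, c g * (X (u g) ω * X (w g) ω) = (∑ g, Z g) ω := congrFun hsum
  simp only [hpow]
  refine lintegral_pow_le_of_mgf_le hW (fun t ht => ?_) (fun t ht => ?_) m
  · exact hZ.integrable_exp_mul_sum mZ fun g _ => (hterm t ht g).1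
  · rw [hZ.mgf_sum mZ]
    calc _ ≤ ∏ g : F, Real.exp (t ^ 2 * (c g ^ 2 * (v (u g) * v (w g)))) :=
          Finset.prod_le_prod (fun g _ => mgf_nonneg) fun g _ => (hterm t ht g).2
      _ ≤ _ := by
          rw [← Real.exp_sum, ← Finset.mul_sum,
            Finset.sum_coe_sort F fun g => c g ^ 2 * ((v (u g) : ℝ) * v (w g))]
          gcongr

end Moments

/-! ### The measure `μ^H` as the image of a family of independent real Gaussian variables -/

/-- The variance `C_H |k|^{-4H}`. -/
def varH (H : ℝ) (k : ℤ × ℤ) : ℝ≥0 := (constC H / len k ^ (4 * H)).toNNReal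

/-- Independent variables `N(0, C_H |k|^{-4H})`, two for each `k ∈ ℤ²₊`. -/
def gaussFam (H : ℝ) : Measure (halfLattice × Fin 2 → ℝ) :=
  Measure.infinitePi fun p => gaussianReal 0 (varH H p.1)

instance (H : ℝ) : IsProbabilityMeasure (gaussFam H) := by unfold gaussFam; infer_instance

/-- Coefficients with prescribed real and imaginary parts on `ℤ²₊`. -/
def assemble (y : halfLattice × Fin 2 → ℝ) : Coeff := reflect fun k => ⟨y (k, 0), y (k, 1)⟩

lemma measurable_complex_mk {α : Type*} [MeasurableSpace α] {f g : α → ℝ} (hf : Measurable f)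
    (hg : Measurable g) : Measurable fun x => (⟨f x, g x⟩ : ℂ) :=
  Complex.measurableEquivRealProd.symm.measurable.comp (hf.prodMk hg)

lemma measurable_reflect {α : Type*} [MeasurableSpace α] {f : α → halfLattice → ℂ}
    (hf : ∀ k, Measurable fun x => f x k) : Measurable fun x => reflect (f x) := by
  refine measurable_pi_lambda _ fun k => ?_
  unfold reflect
  by_cases h : k ∈ halfLattice
  · simpa only [h, dif_pos] using hf _
  by_cases h' : -k ∈ halfLattice
  · simp only [h, h', dif_pos, dif_neg, not_false_eq_true]
    exact (Complex.continuous_conj.measurable.comp (hf _)).neg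
  · simp only [h, h', dif_neg, not_false_eq_true]
    exact measurable_const

lemma measurable_assemble : Measurable assemble :=
  measurable_reflect fun _ => measurable_complex_mk (by fun_prop) (by fun_prop)

/-- The variables of the pairs are flattened into one independent real family, the form needed for
the moment bounds and for the law of the Stokes process. -/
lemma muH_eq (H : ℝ) : muH H = (gaussFam H).map assemble := by
  have h1 : (Measure.infinitePi fun k : halfLattice => modeLaw H k) =
      (gaussFam H).map fun y k => (y (k, 0), y (k, 1)) := by
    have e : (fun (y : halfLattice × Fin 2 → ℝ) (k : halfLattice) => (y (k, 0), y (k, 1))) =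
        (fun x k => MeasurableEquiv.finTwoArrow (x k)) ∘
          MeasurableEquiv.curry halfLattice (Fin 2) ℝ := rfl
    rw [e, ← Measure.map_map (by fun_prop) (by fun_prop), gaussFam,
      Measure.infinitePi_map_curry fun (i : halfLattice) (_ : Fin 2) => gaussianReal 0 (varH H i),
      Measure.infinitePi_map_pi _ fun i => by fun_prop]
    congr 1
    ext1 k
    rw [Measure.infinitePi_eq_pi, (measurePreserving_finTwoArrow (gaussianReal 0 (varH H k))).map_eq]
    rfl
  rw [muH, h1, Measure.map_map]
  · rfl
  · exact measurable_reflect fun _ => measurable_complex_mk (by fun_prop) (by fun_prop)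
  · fun_prop

instance (H : ℝ) : IsProbabilityMeasure (muH H) := by
  rw [muH_eq]; exact Measure.isProbabilityMeasure_map measurable_assemble.aemeasurable

lemma neg_mem_halfLattice {k : ℤ × ℤ} (hk : k ≠ 0) (h : k ∉ halfLattice) : -k ∈ halfLattice := by
  simp only [halfLattice, mem_ofPred_eq, not_or, not_and, not_lt, Prod.fst_neg, Prod.snd_neg] at h ⊢
  have : k.1 ≠ 0 ∨ k.2 ≠ 0 := by
    by_contra! hc; exact hk (Prod.ext hc.1 hc.2)
  omega

lemma neg_notMem_halfLattice {k : ℤ × ℤ} (h : k ∈ halfLattice) : -k ∉ halfLattice := by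
  simp only [halfLattice, mem_ofPred_eq, Prod.fst_neg, Prod.snd_neg] at h ⊢
  omega

lemma reflect_zero (w : halfLattice → ℂ) : reflect w 0 = 0 := by
  simp [reflect, halfLattice]

lemma reflect_neg (w : halfLattice → ℂ) (k : ℤ × ℤ) :
    reflect w (-k) = -(starRingEnd ℂ) (reflect w k) := by
  rcases eq_or_ne k 0 with rfl | hk
  · simp [reflect_zero]
  by_cases h : k ∈ halfLattice
  · simp [reflect, h, neg_notMem_halfLattice h]
  · simp [reflect, h, neg_mem_halfLattice hk h]

lemma halfLattice_ne_zero (k : halfLattice) : (k : ℤ × ℤ) ≠ 0 := by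
  intro h
  have := k.2
  rw [h] at this
  simp [halfLattice] at this

open Classical in
/-- The representative of `±h` in `ℤ²₊`, for `h ≠ 0`. -/
def mode (h : ℤ × ℤ) : halfLattice :=
  if h1 : h ∈ halfLattice then ⟨h, h1⟩
  else if h2 : -h ∈ halfLattice then ⟨-h, h2⟩ else ⟨(1, 0), Or.inl one_pos⟩

lemma mode_eq_or {h : ℤ × ℤ} (hh : h ≠ 0) : (mode h : ℤ × ℤ) = h ∨ (mode h : ℤ × ℤ) = -h := by
  by_cases h1 : h ∈ halfLattice
  · left; simp [mode, h1]
  · right; simp [mode, h1, neg_mem_halfLattice hh h1]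

lemma len_mode {h : ℤ × ℤ} (hh : h ≠ 0) : len (mode h) = len h := by
  rcases mode_eq_or hh with e | e <;> rw [e]
  exact len_neg h

lemma eq_or_eq_neg_of_mode_eq {h h' : ℤ × ℤ} (hh : h ≠ 0) (hh' : h' ≠ 0) (e : mode h = mode h') :
    h' = h ∨ h' = -h := by
  have e' : (mode h : ℤ × ℤ) = mode h' := by rw [e]
  rcases mode_eq_or hh with a | a <;> rcases mode_eq_or hh' with b | b <;> rw [a, b] at e'
  · exact .inl e'.symm
  · right; rw [e', neg_neg]
  · exact .inr e'.symm
  · left; exact (neg_injective e').symm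

/-- Real (`b = 0`) and imaginary (`b = 1`) part. -/
def part (b : Fin 2) (c : ℂ) : ℝ := if b = 0 then c.re else c.im

open Classical in
/-- The sign relating `part b (z h)` to the variable of the mode of `h`. -/
def modeSign (b : Fin 2) (h : ℤ × ℤ) : ℝ := if b = 0 ∧ h ∉ halfLattice then -1 else 1

lemma modeSign_sq (b : Fin 2) (h : ℤ × ℤ) : modeSign b h ^ 2 = 1 := by
  unfold modeSign; split_ifs <;> norm_num

lemma part_assemble (b : Fin 2) {h : ℤ × ℤ} (hh : h ≠ 0) (y : halfLattice × Fin 2 → ℝ) :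
    part b (assemble y h) = modeSign b h * y (mode h, b) := by
  by_cases h1 : h ∈ halfLattice
  · fin_cases b <;> simp [part, assemble, reflect, modeSign, mode, h1]
  · fin_cases b <;> simp [part, assemble, reflect, modeSign, mode, h1, neg_mem_halfLattice hh h1]

/-! ### Moments of the quadratic sums -/

/-- `h^⊥ · k`. -/
def perp (k h : ℤ × ℤ) : ℤ := -h.2 * k.1 + h.1 * k.2

lemma gam_eq_zero {h k : ℤ × ℤ} (hp : perp k h = 0) : gam h k = 0 := by
  rw [gam, show -h.2 * k.1 + h.1 * k.2 = 0 from hp]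
  simp

/-- A colouring of the frequencies `h` such that the products `z_h z_{k-h}` with `h` of one colour
involve pairwise distinct modes. -/
def colour (k h : ℤ × ℤ) : Bool × Bool :=
  (decide (0 < perp k h),
    decide (Even ((h.1 * k.1 + h.2 * k.2) / (k.1 * k.1 + k.2 * k.2))))

lemma ne_zero_of_perp {k h : ℤ × ℤ} (hp : perp k h ≠ 0) : h ≠ 0 ∧ k - h ≠ 0 := by
  constructor
  · rintro rfl; simp [perp] at hp
  · intro e
    rw [← sub_eq_zero.mp e] at hp
    exact hp (by unfold perp; ring)

lemma perp_pos_iff_of_colour {k h h' : ℤ × ℤ} (hc : colour k h = colour k h') :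
    0 < perp k h ↔ 0 < perp k h' := by
  have := congrArg Prod.fst hc
  simpa [colour] using this

/-- A coincidence of modes leaves, besides h' = h, only h' = -h, h' = 2k - h, h' = k - h or h' = h +
k. The first three reverse the sign of h^⊥·k. The last one raises the integer quotient of h·k by
|k|² by one and so changes its parity. The case h' = h of the third claim shows that h and k-h have
different modes. -/
lemma mode_ne_of_colour {k h h' : ℤ × ℤ} (hp : perp k h ≠ 0) (hp' : perp k h' ≠ 0)
    (hc : colour k h = colour k h') :
    (mode h = mode h' → h = h') ∧ (mode (k - h) = mode (k - h') → h = h') ∧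
      mode h ≠ mode (k - h') := by
  have hpos := perp_pos_iff_of_colour hc
  obtain ⟨h0, hk0⟩ := ne_zero_of_perp hp
  obtain ⟨h0', hk0'⟩ := ne_zero_of_perp hp'
  have flip : perp k h' ≠ -perp k h := by intro e; omega
  refine ⟨fun e => ?_, fun e => ?_, fun e => ?_⟩
  · rcases eq_or_eq_neg_of_mode_eq h0 h0' e with e | e
    · exact e.symm
    · refine absurd ?_ flip
      rw [e]; simp only [perp, Prod.fst_neg, Prod.snd_neg]; ring
  · rcases eq_or_eq_neg_of_mode_eq hk0 hk0' e with e | e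
    · exact (sub_right_injective e).symm
    · refine absurd ?_ flip
      have : h' = k + (k - h) := by
        have : h' = k - (k - h') := by abel
        rw [this, e, sub_neg_eq_add]
      rw [this]; simp only [perp, Prod.fst_add, Prod.snd_add, Prod.fst_sub, Prod.snd_sub]; ring
  · rcases eq_or_eq_neg_of_mode_eq h0 hk0' e with e | e
    · refine absurd ?_ flip
      have : h' = k - h := by rw [← e]; abel
      rw [this]; simp only [perp, Prod.fst_sub, Prod.snd_sub]; ring
    · have e2 : h' = h + k := by
        have : h' = k - (k - h') := by abel
        rw [this, e]; abel
      have hpar : Even ((h.1 * k.1 + h.2 * k.2) / (k.1 * k.1 + k.2 * k.2)) ↔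
          Even ((h'.1 * k.1 + h'.2 * k.2) / (k.1 * k.1 + k.2 * k.2)) := by
        have := congrArg Prod.snd hc
        simpa [colour] using this
      have hk : k.1 * k.1 + k.2 * k.2 ≠ 0 := by
        intro h
        have h1 : k.1 = 0 := by nlinarith [mul_self_nonneg k.1, mul_self_nonneg k.2]
        have h2 : k.2 = 0 := by nlinarith [mul_self_nonneg k.1, mul_self_nonneg k.2]
        exact hp (by simp [perp, h1, h2])
      have e3 : h'.1 * k.1 + h'.2 * k.2 =
          (h.1 * k.1 + h.2 * k.2) + (k.1 * k.1 + k.2 * k.2) := by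
        rw [e2, Prod.fst_add, Prod.snd_add]; ring
      rw [e3, Int.add_ediv_of_dvd_right dvd_rfl, Int.ediv_self hk, Int.even_add_one] at hpar
      tauto

/-- The partial sum over `F` of the series for `B_k(z,z)`, without the factor `i`. -/
def quadSum (k : ℤ × ℤ) (F : Finset (ℤ × ℤ)) (z : Coeff) : ℂ :=
  ∑ h ∈ F, (gam h k : ℂ) * z h * z (k - h)

/-- The sum over `F` of the variances of the terms of the series for `B_k(z,z)`. -/
def quadVar (H : ℝ) (k : ℤ × ℤ) (F : Finset (ℤ × ℤ)) : ℝ :=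
  ∑ h ∈ F.filter (fun h => perp k h ≠ 0), gam h k ^ 2 * (varH H h * varH H (k - h))

/-- The sum of products of real parts `b.1`, `b.2` over the frequencies of one colour. -/
def colourSum (k : ℤ × ℤ) (F : Finset (ℤ × ℤ)) (c : Bool × Bool) (b : Fin 2 × Fin 2)
    (z : Coeff) : ℝ :=
  ∑ h ∈ F.filter (fun h => perp k h ≠ 0) with colour k h = c,
    gam h k * (part b.1 (z h) * part b.2 (z (k - h)))

lemma varH_mode {h : ℤ × ℤ} (hh : h ≠ 0) (H : ℝ) : varH H (mode h) = varH H h := by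
  rw [varH, varH, len_mode hh]

/-- Within one colour the modes are distinct, so the bound for sums of independent products applies.
The reflection signs enter the coefficients and disappear on squaring. -/
lemma lintegral_colourSum_le (H : ℝ) (k : ℤ × ℤ) (F : Finset (ℤ × ℤ)) (c : Bool × Bool)
    (b : Fin 2 × Fin 2) {W : ℝ} (hW : 0 < W) (hV : quadVar H k F ≤ W) (m : ℕ) :
    ∫⁻ y, ENNReal.ofReal (colourSum k F c b (assemble y) ^ (2 * m)) ∂gaussFam H ≤
      ENNReal.ofReal (4 * (2 * m).factorial * (2 * W) ^ m) := by
  set G := (F.filter fun h => perp k h ≠ 0).filter fun h => colour k h = c with hG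
  have hmem : ∀ h ∈ G, perp k h ≠ 0 ∧ colour k h = c := fun h hh => by
    simp only [hG, Finset.mem_filter] at hh; exact ⟨hh.1.2, hh.2⟩
  have hcoord : ∀ p, (gaussFam H).map (fun y => y p) = gaussianReal 0 (varH H p.1) :=
    fun p => Measure.infinitePi_map_eval _ p
  have hind : iIndepFun (fun p (y : halfLattice × Fin 2 → ℝ) => y p) (gaussFam H) :=
    iIndepFun_infinitePi (P := fun p : halfLattice × Fin 2 => gaussianReal 0 (varH H p.1))
      (X := fun _ x => x) fun _ => measurable_id
  have key := lintegral_sum_mul_pow_le (fun p => measurable_pi_apply p) hind hcoord G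
    (fun h => gam h k * (modeSign b.1 h * modeSign b.2 (k - h)))
    (fun h => (mode h, b.1)) (fun h => (mode (k - h), b.2)) ?_ ?_ ?_ hW ?_ m
  · convert key using 5 with y
    refine Finset.sum_congr rfl fun h hh => ?_
    obtain ⟨h0, hk0⟩ := ne_zero_of_perp (hmem h hh).1
    rw [part_assemble _ h0, part_assemble _ hk0]; ring
  · intro h hh h' hh' e
    exact (mode_ne_of_colour (hmem h hh).1 (hmem h' hh').1
      ((hmem h hh).2.trans (hmem h' hh').2.symm)).1 (Prod.mk.inj e).1
  · intro h hh h' hh' e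
    exact (mode_ne_of_colour (hmem h hh).1 (hmem h' hh').1
      ((hmem h hh).2.trans (hmem h' hh').2.symm)).2.1 (Prod.mk.inj e).1
  · intro h hh h' hh' e
    exact (mode_ne_of_colour (hmem h hh).1 (hmem h' hh').1
      ((hmem h hh).2.trans (hmem h' hh').2.symm)).2.2 (Prod.mk.inj e).1
  · refine le_trans ?_ hV
    refine le_trans (le_of_eq ?_) (Finset.sum_le_sum_of_subset_of_nonneg
      (Finset.filter_subset (fun h => colour k h = c) _) fun h _ _ => by positivity)
    refine Finset.sum_congr rfl fun h hh => ?_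
    obtain ⟨h0, hk0⟩ := ne_zero_of_perp (hmem h hh).1
    rw [varH_mode h0, varH_mode hk0, mul_pow, mul_pow, modeSign_sq, modeSign_sq]; ring

/-- Four colours times four choices of real or imaginary parts give sixteen sums; parallel
frequencies drop out because `gam` vanishes there. -/
lemma norm_quadSum_le (k : ℤ × ℤ) (F : Finset (ℤ × ℤ)) (z : Coeff) :
    ‖quadSum k F z‖ ≤ ∑ p : (Bool × Bool) × (Fin 2 × Fin 2), |colourSum k F p.1 p.2 z| := by
  have hb : ∀ b, ∑ c, colourSum k F c b z =
      ∑ h ∈ F.filter (fun h => perp k h ≠ 0), gam h k * (part b.1 (z h) * part b.2 (z (k - h))) :=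
    fun b => Finset.sum_fiberwise _ _ _
  have h1 : quadSum k F z =
      ∑ h ∈ F.filter (fun h => perp k h ≠ 0), (gam h k : ℂ) * z h * z (k - h) := by
    refine (Finset.sum_filter_of_ne (p := fun h => perp k h ≠ 0) fun h _ hne hp => hne ?_).symm
    rw [gam_eq_zero hp]; simp
  have hre : (quadSum k F z).re =
      ∑ c, colourSum k F c (0, 0) z - ∑ c, colourSum k F c (1, 1) z := by
    rw [hb, hb, h1, Complex.re_sum, ← Finset.sum_sub_distrib]
    refine Finset.sum_congr rfl fun h _ => ?_
    simp [part]; ring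
  have him : (quadSum k F z).im =
      ∑ c, colourSum k F c (0, 1) z + ∑ c, colourSum k F c (1, 0) z := by
    rw [hb, hb, h1, Complex.im_sum, ← Finset.sum_add_distrib]
    refine Finset.sum_congr rfl fun h _ => ?_
    simp [part]; ring
  have habs : ∀ b, |∑ c, colourSum k F c b z| ≤ ∑ c, |colourSum k F c b z| :=
    fun b => Finset.abs_sum_le_sum_abs _ _
  rw [Fintype.sum_prod_type_right, Fintype.sum_prod_type]
  simp only [Fin.sum_univ_two]
  refine (Complex.norm_le_abs_re_add_abs_im _).trans ?_
  rw [hre, him]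
  have := abs_sub (∑ c, colourSum k F c (0, 0) z) (∑ c, colourSum k F c (1, 1) z)
  have := abs_add_le (∑ c, colourSum k F c (0, 1) z) (∑ c, colourSum k F c (1, 0) z)
  linarith [habs (0, 0), habs (0, 1), habs (1, 0), habs (1, 1)]

/-- The constant in the moment bounds for quadratic sums. -/
def momentConst (m : ℕ) : ℝ := 16 ^ (2 * m) * (16 * (4 * (2 * m).factorial * 2 ^ m))

lemma momentConst_pos (m : ℕ) : 0 < momentConst m := by unfold momentConst; positivity

lemma sum_pow_le_card_pow {σ : Type*} {s : Finset σ} (h : s.Nonempty) (f : σ → ℝ)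
    (hf : ∀ i ∈ s, 0 ≤ f i) (n : ℕ) :
    (∑ i ∈ s, f i) ^ n ≤ (s.card : ℝ) ^ n * ∑ i ∈ s, f i ^ n := by
  obtain ⟨j, hj, hmax⟩ := s.exists_max_image f h
  calc (∑ i ∈ s, f i) ^ n ≤ ((s.card : ℝ) * f j) ^ n := by
        refine pow_le_pow_left₀ (Finset.sum_nonneg hf) ?_ n
        simpa using Finset.sum_le_card_nsmul s f (f j) hmax
    _ = (s.card : ℝ) ^ n * f j ^ n := mul_pow _ _ _
    _ ≤ _ := by
        gcongr
        exact Finset.single_le_sum (f := fun i => f i ^ n)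
          (fun i hi => pow_nonneg (hf i hi) n) hj

lemma measurable_quadSum (k : ℤ × ℤ) (F : Finset (ℤ × ℤ)) : Measurable (quadSum k F) := by
  unfold quadSum; fun_prop

lemma measurable_part (b : Fin 2) : Measurable (part b) := by
  unfold part; split_ifs <;> fun_prop

lemma measurable_colourSum (k : ℤ × ℤ) (F : Finset (ℤ × ℤ)) (c : Bool × Bool)
    (b : Fin 2 × Fin 2) : Measurable (colourSum k F c b) := by
  unfold colourSum
  refine Finset.measurable_sum _ fun h _ => ?_
  exact (((measurable_part _).comp (measurable_pi_apply h)).mul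
    ((measurable_part _).comp (measurable_pi_apply (k - h)))).const_mul _

/-- This replaces hypercontractivity: every even moment is controlled by a power of the variance
bound, uniformly in the finite set. -/
lemma lintegral_quadSum_le (H : ℝ) (k : ℤ × ℤ) (F : Finset (ℤ × ℤ)) {W : ℝ} (hW : 0 < W)
    (hV : quadVar H k F ≤ W) (m : ℕ) :
    ∫⁻ z, ‖quadSum k F z‖ₑ ^ (2 * m) ∂muH H ≤ ENNReal.ofReal (momentConst m * W ^ m) := by
  have h1 : ∀ z, ‖quadSum k F z‖ₑ ^ (2 * m) ≤
      ENNReal.ofReal (16 ^ (2 * m)) * ∑ p : (Bool × Bool) × (Fin 2 × Fin 2),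
        ENNReal.ofReal (colourSum k F p.1 p.2 z ^ (2 * m)) := by
    intro z
    have e : ‖quadSum k F z‖ₑ ^ (2 * m) = ENNReal.ofReal (‖quadSum k F z‖ ^ (2 * m)) := by
      rw [ENNReal.ofReal_pow (norm_nonneg _), ofReal_norm]
    have hnn : ∀ p : (Bool × Bool) × (Fin 2 × Fin 2),
        0 ≤ colourSum k F p.1 p.2 z ^ (2 * m) := fun p => by rw [pow_mul]; positivity
    rw [e, ← ENNReal.ofReal_sum_of_nonneg fun p _ => hnn p, ← ENNReal.ofReal_mul (by positivity)]
    refine ENNReal.ofReal_le_ofReal ?_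
    refine (pow_le_pow_left₀ (norm_nonneg _) (norm_quadSum_le k F z) _).trans ?_
    have := sum_pow_le_card_pow Finset.univ_nonempty
      (fun p : (Bool × Bool) × (Fin 2 × Fin 2) => |colourSum k F p.1 p.2 z|)
      (fun _ _ => abs_nonneg _) (2 * m)
    refine this.trans (le_of_eq ?_)
    congr 1
    refine Finset.sum_congr rfl fun p _ => ?_
    rw [pow_mul, sq_abs, ← pow_mul]
  rw [muH_eq, lintegral_map ((measurable_quadSum k F).enorm.pow_const _) measurable_assemble]
  refine (lintegral_mono fun y => h1 (assemble y)).trans ?_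
  rw [lintegral_const_mul' _ _ ENNReal.ofReal_ne_top, lintegral_finsetSum]
  · refine (mul_le_mul_right (Finset.sum_le_sum fun p _ =>
      lintegral_colourSum_le H k F p.1 p.2 hW hV m) _).trans (le_of_eq ?_)
    rw [Finset.sum_const, nsmul_eq_mul, ← ENNReal.ofReal_natCast, ← ENNReal.ofReal_mul (by positivity),
      ← ENNReal.ofReal_mul (by positivity)]
    congr 1
    simp [momentConst, mul_pow]; ring
  · intro p _
    exact (((measurable_colourSum k F p.1 p.2).comp measurable_assemble).pow_const _).ennreal_ofReal

/-! ### Summation in `L^{2m}` and almost sure convergence -/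

section LpSums

variable {Ω ι : Type*} [MeasurableSpace Ω] {μ : Measure Ω}

lemma eLpNorm_natCast_pow {E : Type*} [NormedAddCommGroup E] {n : ℕ} (hn : n ≠ 0) (f : Ω → E) :
    eLpNorm f n μ ^ n = ∫⁻ ω, ‖f ω‖ₑ ^ n ∂μ := by
  have h := eLpNorm_nnreal_pow_eq_lintegral (μ := μ) (f := f) (p := (n : ℝ≥0)) (by exact_mod_cast hn)
  simpa using h

/-- The difference of two nested partial sums is the partial sum over the set difference, so
summability of `V` makes the net Cauchy in L^{2m}. Letting the larger set grow turns the same bound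
into the tail estimate. -/
lemma exists_lp_limit [IsProbabilityMeasure μ] {f : ι → Ω → ℂ} (hf : ∀ i, Measurable (f i))
    {V : ι → ℝ} (hV : Summable V) {c : ℝ} (hc : 0 < c) {m : ℕ} (hm : m ≠ 0)
    (hbound : ∀ (F : Finset ι) (W : ℝ), 0 < W → ∑ i ∈ F, V i ≤ W →
      ∫⁻ ω, ‖∑ i ∈ F, f i ω‖ₑ ^ (2 * m) ∂μ ≤ ENNReal.ofReal (c * W ^ m)) :
    ∃ M : Ω → ℂ, AEStronglyMeasurable M μ ∧
      Tendsto (fun F : Finset ι => eLpNorm (fun ω => ∑ i ∈ F, f i ω - M ω) ((2 * m : ℕ) : ℝ≥0∞) μ)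
        atTop (𝓝 0) ∧
      ∀ (F₀ : Finset ι) (W : ℝ), 0 < W → (∀ F, Disjoint F F₀ → ∑ i ∈ F, V i ≤ W) →
        ∫⁻ ω, ‖∑ i ∈ F₀, f i ω - M ω‖ₑ ^ (2 * m) ∂μ ≤ ENNReal.ofReal (c * W ^ m) := by
  classical
  have hm2 : 2 * m ≠ 0 := by omega
  have hp : Fact ((1 : ℝ≥0∞) ≤ ((2 * m : ℕ) : ℝ≥0∞)) := ⟨by exact_mod_cast (by omega : 1 ≤ 2 * m)⟩
  let S : Finset ι → Ω → ℂ := fun F ω => ∑ i ∈ F, f i ω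
  have hS : ∀ F, Measurable (S F) := fun F => Finset.measurable_sum _ fun i _ => hf i
  have hmem : ∀ F, MemLp (S F) ((2 * m : ℕ) : ℝ≥0∞) μ := fun F => by
    refine ⟨(hS F).aestronglyMeasurable, ?_⟩
    have h := hbound F (max 1 (∑ i ∈ F, V i)) (by positivity) (le_max_right _ _)
    rw [← eLpNorm_natCast_pow hm2] at h
    by_contra! htop
    rw [top_le_iff.mp htop, ENNReal.top_pow hm2] at h
    exact absurd h (by simp)
  have hsub : ∀ F₀ F, F₀ ⊆ F → (fun ω => S F ω - S F₀ ω) = S (F \ F₀) := fun F₀ F hF => by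
    ext ω
    simp only [S, ← Finset.sum_sdiff hF, add_sub_cancel_right]
  let G : Finset ι → Lp ℂ ((2 * m : ℕ) : ℝ≥0∞) μ := fun F => (hmem F).toLp
  have hdist : ∀ F₀ F, F₀ ⊆ F → ∀ W : ℝ, 0 < W → ∑ i ∈ F \ F₀, V i ≤ W →
      dist (G F) (G F₀) ^ (2 * m) ≤ c * W ^ m := by
    intro F₀ F hF W hW hVW
    have e : dist (G F) (G F₀) = (eLpNorm (S (F \ F₀)) ((2 * m : ℕ) : ℝ≥0∞) μ).toReal := by
      rw [dist_eq_norm, ← MemLp.toLp_sub, Lp.norm_toLp, ← hsub F₀ F hF]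
      rfl
    rw [e, ← ENNReal.toReal_pow, eLpNorm_natCast_pow hm2]
    exact ENNReal.toReal_le_of_le_ofReal (by positivity) (hbound _ W hW hVW)
  have hcauchy : CauchySeq G := by
    rw [Metric.cauchySeq_iff']
    intro ε hε
    -- As W ≤ 1 and m ≥ 1, c W^m ≤ c W ≤ ε^{2m}/2.
    set W : ℝ := min 1 (ε ^ (2 * m) / (2 * c)) with hWdef
    have hW : 0 < W := lt_min one_pos (by positivity)
    obtain ⟨F₀, hF₀⟩ := summable_iff_vanishing_norm.mp hV W hW
    refine ⟨F₀, fun F hF => ?_⟩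
    have h1 := hdist F₀ F hF W hW ((le_abs_self _).trans (hF₀ _ Finset.sdiff_disjoint).le)
    have h2 : c * W ^ m < ε ^ (2 * m) := by
      have h3 : W ^ m ≤ W := pow_le_of_le_one hW.le (min_le_left _ _) hm
      have h4 : W ≤ ε ^ (2 * m) / (2 * c) := min_le_right _ _
      rw [le_div_iff₀ (by positivity)] at h4
      have h5 : 0 < ε ^ (2 * m) := by positivity
      nlinarith
    exact lt_of_pow_lt_pow_left₀ _ hε.le (h1.trans_lt h2)
  obtain ⟨M, hM⟩ := cauchySeq_tendsto_of_complete hcauchy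
  have hae : ∀ F, eLpNorm (⇑(G F) - ⇑M) ((2 * m : ℕ) : ℝ≥0∞) μ =
      eLpNorm (fun ω => S F ω - M ω) ((2 * m : ℕ) : ℝ≥0∞) μ := fun F =>
    eLpNorm_congr_ae (by filter_upwards [(hmem F).coeFn_toLp] with ω hω; simp [G, hω])
  refine ⟨M, Lp.aestronglyMeasurable M, ?_, fun F₀ W hW hF₀ => ?_⟩
  · have := (Lp.tendsto_Lp_iff_tendsto_eLpNorm' G M).mp hM
    simpa only [hae] using this
  · have h1 : dist M (G F₀) ^ (2 * m) ≤ c * W ^ m := by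
      refine le_of_tendsto ((hM.dist tendsto_const_nhds).pow (2 * m)) ?_
      filter_upwards [eventually_ge_atTop F₀] with F hF
      exact hdist F₀ F hF W hW (hF₀ _ Finset.sdiff_disjoint)
    rw [dist_comm, Lp.dist_def, hae, ← ENNReal.toReal_pow, eLpNorm_natCast_pow hm2] at h1
    rw [← ENNReal.ofReal_toReal (a := ∫⁻ ω, ‖∑ i ∈ F₀, f i ω - M ω‖ₑ ^ (2 * m) ∂μ)]
    · exact ENNReal.ofReal_le_ofReal h1
    · rw [← eLpNorm_natCast_pow hm2]
      exact ENNReal.pow_ne_top (((hmem F₀).sub (Lp.memLp M)).eLpNorm_ne_top)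

/-- The sum over N of the n-th powers of the errors has finite integral, hence is almost surely
finite, and its terms tend to 0. -/
lemma ae_tendsto_of_lintegral_pow_le {S : ℕ → Ω → ℂ} {M : Ω → ℂ}
    (hS : ∀ N, Measurable (S N)) (hM : AEStronglyMeasurable M μ) {n : ℕ} (hn : n ≠ 0)
    {B : ℕ → ℝ} (hB : Summable B)
    (h : ∀ᶠ N in atTop, ∫⁻ ω, ‖S N ω - M ω‖ₑ ^ n ∂μ ≤ ENNReal.ofReal (B N)) :
    ∀ᵐ ω ∂μ, Tendsto (fun N => S N ω) atTop (𝓝 (M ω)) := by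
  obtain ⟨N₀, hN₀⟩ := eventually_atTop.mp h
  have hmeas : ∀ N, AEMeasurable (fun ω => ‖S (N + N₀) ω - M ω‖ₑ ^ n) μ := fun N =>
    (((hS _).aestronglyMeasurable.sub hM).enorm).pow_const n
  have hfin : ∫⁻ ω, ∑' N, ‖S (N + N₀) ω - M ω‖ₑ ^ n ∂μ ≠ ∞ := by
    rw [lintegral_tsum hmeas]
    refine ne_top_of_le_ne_top ?_ (ENNReal.tsum_le_tsum fun N => hN₀ (N + N₀) (by omega))
    exact ((summable_nat_add_iff N₀).mpr hB).tsum_ofReal_ne_top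
  filter_upwards [ae_lt_top' (AEMeasurable.tsum hmeas) hfin] with ω hω
  have h0 := ENNReal.tendsto_atTop_zero_of_tsum_ne_top hω.ne
  have h1 : Tendsto (fun N => ‖S (N + N₀) ω - M ω‖ₑ) atTop (𝓝 0) := by
    have := (ENNReal.continuous_rpow_const (y := (n : ℝ)⁻¹)).tendsto 0 |>.comp h0
    rw [ENNReal.zero_rpow_of_pos (by positivity)] at this
    refine this.congr fun N => ?_
    simp only [Function.comp]
    rw [← ENNReal.rpow_natCast, ← ENNReal.rpow_mul, mul_inv_cancel₀ (by exact_mod_cast hn),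
      ENNReal.rpow_one]
  rw [← tendsto_add_atTop_iff_nat N₀, tendsto_iff_edist_tendsto_0]
  simpa only [edist_eq_enorm_sub] using h1

/-- Jensen's inequality for x^{n+1} with weights u, first on finite sets. -/
lemma tsum_pow_le_of_weights {κ : Type*} (u f : κ → ℝ≥0∞) (hu : ∀ k, u k ≠ 0)
    (hu' : ∀ k, u k ≠ ∞) (n : ℕ) :
    (∑' k, f k) ^ (n + 1) ≤ (∑' k, u k) ^ n * ∑' k, u k * (f k / u k) ^ (n + 1) := by
  have hfin : ∀ s : Finset κ, (∑ k ∈ s, f k) ^ (n + 1) ≤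
      (∑' k, u k) ^ n * ∑' k, u k * (f k / u k) ^ (n + 1) := by
    intro s
    have hp : (1 : ℝ) ≤ ((n + 1 : ℕ) : ℝ) := by push_cast; linarith [Nat.cast_nonneg (α := ℝ) n]
    have h := ENNReal.inner_le_weight_mul_Lp_of_nonneg s hp u fun k => f k / u k
    have e1 : ∑ k ∈ s, u k * (f k / u k) = ∑ k ∈ s, f k :=
      Finset.sum_congr rfl fun k _ => ENNReal.mul_div_cancel (hu k) (hu' k)
    rw [e1] at h
    have h2 := pow_le_pow_left₀ (zero_le) h (n + 1)
    refine h2.trans ?_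
    rw [mul_pow]
    simp only [ENNReal.rpow_natCast]
    have e2 : ((∑ k ∈ s, u k) ^ (1 - ((n + 1 : ℕ) : ℝ)⁻¹)) ^ (n + 1) = (∑ k ∈ s, u k) ^ n := by
      rw [← ENNReal.rpow_natCast, ← ENNReal.rpow_mul, ← ENNReal.rpow_natCast]
      congr 1; push_cast; field_simp; ring
    have e3 : ∀ x : ℝ≥0∞, (x ^ ((n + 1 : ℕ) : ℝ)⁻¹) ^ (n + 1) = x := fun x => by
      rw [← ENNReal.rpow_natCast, ← ENNReal.rpow_mul, inv_mul_cancel₀ (by positivity),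
        ENNReal.rpow_one]
    rw [e2, e3]
    gcongr
    · exact ENNReal.sum_le_tsum s
    · exact ENNReal.sum_le_tsum s
  have hlim := (ENNReal.continuous_pow (n + 1)).tendsto _ |>.comp
    (ENNReal.summable (f := f)).hasSum
  exact le_of_tendsto hlim (Eventually.of_forall hfin)

/-- The weights in Jensen's inequality are the size bounds u_k themselves, so each normalised term
has (n+1)-st moment at most c. Dividing by u_k requires its strict positivity. -/
lemma lintegral_tsum_pow_lt_top {κ : Type*} [Countable κ] {u : κ → ℝ} (hu : ∀ k, 0 < u k)
    (hsum : Summable u) {f : κ → Ω → ℝ≥0∞} (hf : ∀ k, AEMeasurable (f k) μ) {c : ℝ}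
    {n : ℕ} (hbound : ∀ k, ∫⁻ ω, f k ω ^ (n + 1) ∂μ ≤ ENNReal.ofReal (c * u k ^ (n + 1))) :
    ∫⁻ ω, (∑' k, f k ω) ^ (n + 1) ∂μ < ∞ := by
  have hu0 : ∀ k, ENNReal.ofReal (u k) ≠ 0 := fun k => by simpa using hu k
  calc ∫⁻ ω, (∑' k, f k ω) ^ (n + 1) ∂μ
      ≤ ∫⁻ ω, (∑' k, ENNReal.ofReal (u k)) ^ n *
          ∑' k, ENNReal.ofReal (u k) * (f k ω / ENNReal.ofReal (u k)) ^ (n + 1) ∂μ :=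
        lintegral_mono fun ω => tsum_pow_le_of_weights _ _ hu0 (fun _ => ENNReal.ofReal_ne_top) n
    _ = (∑' k, ENNReal.ofReal (u k)) ^ n *
          ∑' k, ∫⁻ ω, ENNReal.ofReal (u k) * (f k ω / ENNReal.ofReal (u k)) ^ (n + 1) ∂μ := by
        rw [lintegral_const_mul' _ _ (ENNReal.pow_ne_top hsum.tsum_ofReal_ne_top),
          lintegral_tsum fun k => (((hf k).div_const _).pow_const _).const_mul _]
    _ ≤ (∑' k, ENNReal.ofReal (u k)) ^ n * ∑' k, ENNReal.ofReal (u k) * ENNReal.ofReal c := by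
        gcongr with k
        rw [lintegral_const_mul' _ _ ENNReal.ofReal_ne_top]
        gcongr
        simp only [div_eq_mul_inv, mul_pow]
        rw [lintegral_mul_const' _ _ (ENNReal.pow_ne_top (ENNReal.inv_ne_top.mpr (hu0 k)))]
        refine (mul_le_mul_left (hbound k) _).trans (le_of_eq ?_)
        rw [ENNReal.ofReal_mul' (by have := hu k; positivity), ENNReal.ofReal_pow (hu k).le, mul_assoc,
          ← mul_pow, ENNReal.mul_inv_cancel (hu0 k) ENNReal.ofReal_ne_top, one_pow, mul_one]
    _ < ∞ := by
        rw [ENNReal.tsum_mul_right]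
        exact ENNReal.mul_lt_top (ENNReal.pow_lt_top hsum.tsum_ofReal_ne_top.lt_top)
          (ENNReal.mul_lt_top hsum.tsum_ofReal_ne_top.lt_top ENNReal.ofReal_lt_top)

end LpSums

/-! ### Well-posedness of `B(z,z)` under `μ^H` -/

open Classical in
/-- The frequencies `h` contributing to `B_k(Π_N z, Π_N z)`. -/
def ball (k : ℤ × ℤ) (N : ℕ) : Finset (ℤ × ℤ) :=
  (Finset.Icc ((-N : ℤ), (-N : ℤ)) ((N : ℤ), (N : ℤ))).filter
    fun h => len h ≤ N ∧ len (k - h) ≤ N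

lemma abs_fst_le_len (k : ℤ × ℤ) : |(k.1 : ℝ)| ≤ len k :=
  Real.abs_le_sqrt (by nlinarith [sq_nonneg (k.2 : ℝ)])

lemma abs_snd_le_len (k : ℤ × ℤ) : |(k.2 : ℝ)| ≤ len k :=
  Real.abs_le_sqrt (by nlinarith [sq_nonneg (k.1 : ℝ)])

lemma mem_ball {k h : ℤ × ℤ} {N : ℕ} : h ∈ ball k N ↔ len h ≤ N ∧ len (k - h) ≤ N := by
  simp only [ball, Finset.mem_filter, and_iff_right_iff_imp, Finset.mem_Icc, Prod.le_def]
  rintro ⟨h1, -⟩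
  have a := abs_le.mp ((abs_fst_le_len h).trans h1)
  have b := abs_le.mp ((abs_snd_le_len h).trans h1)
  exact ⟨⟨by exact_mod_cast a.1, by exact_mod_cast b.1⟩,
    ⟨by exact_mod_cast a.2, by exact_mod_cast b.2⟩⟩

/-- The truncation leaves finitely many h, and `gam` vanishes at h = 0 and h = k, so the series is a
finite sum over `ball k N`. -/
lemma bil_galerkin (z : Coeff) (k : ℤ × ℤ) (N : ℕ) :
    bil (galerkin N z) (galerkin N z) k = Complex.I * quadSum k (ball k N) z := by
  unfold bil
  congr 1
  have e := tsum_subtype_eq_of_support_subset (s := {h : ℤ × ℤ | h ≠ 0 ∧ h ≠ k})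
    (f := fun h => (gam h k : ℂ) * galerkin N z h * galerkin N z (k - h)) fun h hh => by
      constructor
      · rintro rfl; exact hh (by simp [gam])
      · rintro rfl; exact hh (by simp [gam])
  refine e.trans ?_
  rw [tsum_eq_sum (s := ball k N)]
  · refine Finset.sum_congr rfl fun h hh => ?_
    rw [mem_ball] at hh
    simp [galerkin, hh.1, hh.2]
  · intro h hh
    rw [mem_ball, not_and_or] at hh
    rcases hh with hh | hh <;> simp [galerkin, hh]

lemma measurable_quadB (k : ℤ × ℤ) : Measurable fun z => quadB z k := by
  unfold quadB
  refine (StronglyMeasurable.limUnder fun N => ?_).measurable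
  simp only [bil_galerkin]
  exact ((measurable_quadSum k _).const_mul _).stronglyMeasurable

/-- An upper bound, up to the factor `|h|^{-4H} |k-h|^{-4H}`, for the variances of the terms. -/
def varConst (H : ℝ) (k : ℤ × ℤ) : ℝ := (max (constC H) 0 ^ 2 + 1) * len k ^ 2

/-- An upper bound for the variance of the term of index `h` of `B_k(z,z)`. -/
def termVar (H : ℝ) (k h : ℤ × ℤ) : ℝ :=
  varConst H k * (len h ^ (-(4 * H)) * len (k - h) ^ (-(4 * H)))

lemma varConst_nonneg (H : ℝ) (k : ℤ × ℤ) : 0 ≤ varConst H k := by unfold varConst; positivity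

lemma termVar_nonneg (H : ℝ) (k h : ℤ × ℤ) : 0 ≤ termVar H k h :=
  mul_nonneg (varConst_nonneg H k) (mul_nonneg (len_rpow_nonneg _ _) (len_rpow_nonneg _ _))

lemma varH_le (H : ℝ) (h : ℤ × ℤ) : (varH H h : ℝ) ≤ max (constC H) 0 * len h ^ (-(4 * H)) := by
  rw [varH, Real.coe_toNNReal', Real.rpow_neg (len_nonneg _), ← div_eq_mul_inv]
  have := len_rpow_nonneg h (4 * H)
  refine max_le ?_ (by positivity)
  gcongr
  exact le_max_left _ _

lemma quadVar_le (H : ℝ) (k : ℤ × ℤ) (F : Finset (ℤ × ℤ)) :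
    quadVar H k F ≤ ∑ h ∈ F, termVar H k h := by
  refine le_trans (Finset.sum_le_sum fun h _ => ?_) (Finset.sum_le_sum_of_subset_of_nonneg
    (Finset.filter_subset (fun h => perp k h ≠ 0) F) fun h _ _ => termVar_nonneg H k h)
  have h1 : gam h k ^ 2 ≤ len k ^ 2 := sq_le_sq' (abs_le.mp (abs_gam_le h k)).1
    (abs_le.mp (abs_gam_le h k)).2
  have h2 := varH_le H h
  have h3 := varH_le H (k - h)
  have n1 := len_rpow_nonneg h (-(4 * H))
  have n2 := len_rpow_nonneg (k - h) (-(4 * H))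
  calc gam h k ^ 2 * (varH H h * varH H (k - h))
      ≤ len k ^ 2 * ((max (constC H) 0 * len h ^ (-(4 * H))) *
          (max (constC H) 0 * len (k - h) ^ (-(4 * H)))) := by gcongr
    _ = max (constC H) 0 ^ 2 * (len k ^ 2 * (len h ^ (-(4 * H)) * len (k - h) ^ (-(4 * H)))) := by
        ring
    _ ≤ (max (constC H) 0 ^ 2 + 1) *
          (len k ^ 2 * (len h ^ (-(4 * H)) * len (k - h) ^ (-(4 * H)))) := by gcongr; linarith
    _ = termVar H k h := by unfold termVar varConst; ring

lemma summable_termVar {H : ℝ} (hH : 1 / 4 < H) (k : ℤ × ℤ) : Summable (termVar H k) :=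
  (summable_convolution (by linarith) k).mul_left _

/-- Decay of the variance of the terms outside the Galerkin truncation. -/
lemma sum_termVar_tail_le {H : ℝ} (hH : 1 / 4 < H) (k : ℤ × ℤ) {N : ℕ} (hN : 0 < N)
    {F : Finset (ℤ × ℤ)} (hF : Disjoint F (ball k N)) :
    ∑ h ∈ F, termVar H k h ≤ (N : ℝ) ^ (-((4 * H - 1) / 2)) *
      (varConst H k * ∑' h, len h ^ (-((4 * H + 1) / 2)) * len (k - h) ^ (-((4 * H + 1) / 2))) := by
  set δ := (4 * H - 1) / 2 with hδ
  set b := (4 * H + 1) / 2 with hb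
  have hδ0 : 0 < δ := by rw [hδ]; linarith
  have hN0 : (0 : ℝ) < N := by exact_mod_cast hN
  have hs := summable_convolution (b := b) (by rw [hb]; linarith) k
  have nn : ∀ h, 0 ≤ len h ^ (-b) * len (k - h) ^ (-b) :=
    fun h => mul_nonneg (len_rpow_nonneg _ _) (len_rpow_nonneg _ _)
  calc ∑ h ∈ F, termVar H k h
      ≤ ∑ h ∈ F, (N : ℝ) ^ (-δ) * varConst H k * (len h ^ (-b) * len (k - h) ^ (-b)) := by
        refine Finset.sum_le_sum fun h hh => ?_
        have hout : ¬(len h ≤ N ∧ len (k - h) ≤ N) :=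
          fun hm => Finset.disjoint_left.mp hF hh (mem_ball.mpr hm)
        rw [not_and_or, not_le, not_le] at hout
        have hR : 0 ≤ (N : ℝ) ^ (-δ) * varConst H k * (len h ^ (-b) * len (k - h) ^ (-b)) :=
          mul_nonneg (mul_nonneg (by positivity) (varConst_nonneg _ _)) (nn h)
        have hz : (0 : ℝ) ^ (-(4 * H)) = 0 := Real.zero_rpow (by linarith)
        rcases eq_or_ne h 0 with e | e
        · refine le_trans (le_of_eq ?_) hR; rw [termVar, e, len_zero, hz]; simp
        rcases eq_or_ne (k - h) 0 with e' | e'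
        · refine le_trans (le_of_eq ?_) hR; rw [termVar, e', len_zero, hz]; simp
        have hA := one_le_len e
        have hB := one_le_len e'
        have hA0 := len_pos e
        have hB0 := len_pos e'
        -- One of the two lengths exceeds N and the other is at least 1. Splitting 4H = δ + b with b
        -- > 1 then trades δ for the decay in N and leaves a convergent convolution.
        have hprod : (N : ℝ) ≤ len h * len (k - h) := by
          rcases hout with h1 | h1 <;> nlinarith
        have hpow : (len h * len (k - h)) ^ (-δ) ≤ (N : ℝ) ^ (-δ) :=
          Real.rpow_le_rpow_of_nonpos hN0 hprod (by linarith)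
        have e1 : ∀ x : ℝ, 0 < x → x ^ (-(4 * H)) = x ^ (-δ) * x ^ (-b) := fun x hx => by
          rw [← Real.rpow_add hx]; congr 1; rw [hδ, hb]; ring
        rw [Real.mul_rpow hA0.le hB0.le] at hpow
        rw [termVar, e1 _ hA0, e1 _ hB0]
        have := mul_le_mul_of_nonneg_right hpow (mul_nonneg (varConst_nonneg H k) (nn h))
        nlinarith
    _ = (N : ℝ) ^ (-δ) * varConst H k * ∑ h ∈ F, (len h ^ (-b) * len (k - h) ^ (-b)) := by
        rw [Finset.mul_sum]
    _ ≤ (N : ℝ) ^ (-δ) * varConst H k * ∑' h, len h ^ (-b) * len (k - h) ^ (-b) := by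
        refine mul_le_mul_of_nonneg_left (hs.sum_le_tsum _ fun h _ => nn h)
          (mul_nonneg (by positivity) (varConst_nonneg _ _))
    _ = _ := by ring

/-- Adjoining 0 and k adds only zero terms, and makes the index sets cofinal among the finite
subsets of the whole lattice. -/
lemma quadSum_eq_of_subtype (k : ℤ × ℤ) (F : Finset {h : ℤ × ℤ // h ≠ 0 ∧ h ≠ k}) (z : Coeff) :
    quadSum k (F.map (Function.Embedding.subtype _) ∪ {0, k}) z =
      ∑ h ∈ F, (gam h k : ℂ) * z h * z (k - h) := by
  rw [quadSum, ← Finset.sum_subset (Finset.subset_union_left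
    (s₁ := F.map (Function.Embedding.subtype _)))]
  · rw [Finset.sum_map]; rfl
  · intro h hh hh'
    have : h = 0 ∨ h = k := by
      rw [Finset.mem_union] at hh
      simpa using hh.resolve_left hh'
    rcases this with rfl | rfl <;> simp [gam]

lemma tendsto_map_union_atTop (k : ℤ × ℤ) :
    Tendsto (fun F : Finset {h : ℤ × ℤ // h ≠ 0 ∧ h ≠ k} =>
      F.map (Function.Embedding.subtype _) ∪ {0, k}) atTop atTop := by
  refine tendsto_atTop.mpr fun F₀ => ?_
  filter_upwards [eventually_ge_atTop (F₀.subtype fun h => h ≠ 0 ∧ h ≠ k)] with F hF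
  intro h hh
  by_cases hc : h ≠ 0 ∧ h ≠ k
  · refine Finset.mem_union_left _ ?_
    rw [Finset.mem_map]
    exact ⟨⟨h, hc⟩, hF (by simpa using hh), rfl⟩
  · refine Finset.mem_union_right _ ?_
    rw [not_and_or, not_ne_iff, not_ne_iff] at hc
    simpa using hc

/-- Almost sure Galerkin convergence and unconditional `L²` convergence of each coefficient. -/
lemma quadB_converges {H : ℝ} (hH : 1 / 4 < H) (k : ℤ × ℤ) :
    (∀ᵐ z ∂muH H, Tendsto (fun N : ℕ => bil (galerkin N z) (galerkin N z) k) atTop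
      (𝓝 (quadB z k))) ∧
    Tendsto (fun F : Finset {h : ℤ × ℤ // h ≠ 0 ∧ h ≠ k} =>
      eLpNorm (fun z : Coeff => Complex.I * ∑ h ∈ F, (gam h k : ℂ) * z h * z (k - h)
        - quadB z k) 2 (muH H)) atTop (𝓝 0) := by
  set δ := (4 * H - 1) / 2 with hδ
  have hδ0 : 0 < δ := by rw [hδ]; linarith
  -- The 2m-th moment of the Galerkin error is of order N^{-δm}, summable once δm > 1.
  obtain ⟨m, hm⟩ := exists_nat_gt (1 / δ)
  have hmδ : 1 < δ * m := by rwa [div_lt_iff₀' hδ0] at hm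
  have hm0 : m ≠ 0 := by rintro rfl; norm_num at hmδ
  obtain ⟨M, hM, hMlim, hMtail⟩ := exists_lp_limit (μ := muH H)
    (f := fun (h : ℤ × ℤ) (z : Coeff) => (gam h k : ℂ) * z h * z (k - h)) (fun h => by fun_prop)
    (summable_termVar hH k) (momentConst_pos m) hm0 fun F W hW hV =>
      lintegral_quadSum_le H k F hW ((quadVar_le H k F).trans hV) m
  set D : ℝ := varConst H k *
    (∑' h, len h ^ (-((4 * H + 1) / 2)) * len (k - h) ^ (-((4 * H + 1) / 2))) with hD
  have hD0 : 0 ≤ D := mul_nonneg (varConst_nonneg _ _)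
    (tsum_nonneg fun h => mul_nonneg (len_rpow_nonneg _ _) (len_rpow_nonneg _ _))
  have hae : ∀ᵐ z ∂muH H, Tendsto (fun N => quadSum k (ball k N) z) atTop (𝓝 (M z)) := by
    refine ae_tendsto_of_lintegral_pow_le (fun N => measurable_quadSum k _) hM
      (n := 2 * m) (by omega)
      (B := fun N => momentConst m * (((N : ℝ) ^ (-δ)) * (D + 1)) ^ m) ?_ ?_
    · have h1 : Summable fun N : ℕ => (N : ℝ) ^ (-(δ * m)) :=
        Real.summable_nat_rpow.mpr (by linarith)
      refine (h1.mul_left (momentConst m * (D + 1) ^ m)).congr fun N => ?_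
      rw [mul_pow, ← Real.rpow_natCast ((N : ℝ) ^ (-δ)) m, ← Real.rpow_mul (Nat.cast_nonneg N)]
      ring_nf
    · filter_upwards [eventually_gt_atTop 0] with N hN
      have hN0 : (0 : ℝ) < N := by exact_mod_cast hN
      refine hMtail (ball k N) _ (by positivity) fun F hF => ?_
      refine (sum_termVar_tail_le hH k hN hF).trans ?_
      gcongr
      linarith
  have hB : ∀ᵐ z ∂muH H, Tendsto (fun N : ℕ => bil (galerkin N z) (galerkin N z) k) atTop
      (𝓝 (Complex.I * M z)) := by
    filter_upwards [hae] with z hz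
    simpa only [bil_galerkin] using hz.const_mul Complex.I
  have hQ : ∀ᵐ z ∂muH H, quadB z k = Complex.I * M z := by
    filter_upwards [hB] with z hz using hz.limUnder_eq
  refine ⟨?_, ?_⟩
  · filter_upwards [hB, hQ] with z h1 h2
    rwa [h2]
  · refine tendsto_of_tendsto_of_tendsto_of_le_of_le tendsto_const_nhds
      (hMlim.comp (tendsto_map_union_atTop k)) (fun _ => zero_le) fun F => ?_
    have h2 : (2 : ℝ≥0∞) ≤ ((2 * m : ℕ) : ℝ≥0∞) := by
      exact_mod_cast (by omega : 2 ≤ 2 * m)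
    have e : eLpNorm (fun z : Coeff => Complex.I * ∑ h ∈ F, (gam h k : ℂ) * z h * z (k - h)
        - quadB z k) 2 (muH H) =
        eLpNorm (fun z => quadSum k (F.map (Function.Embedding.subtype _) ∪ {0, k}) z - M z) 2
          (muH H) := by
      refine eLpNorm_congr_norm_ae ?_
      filter_upwards [hQ] with z hz
      rw [hz, ← mul_sub, norm_mul, Complex.norm_I, one_mul, quadSum_eq_of_subtype]
    rw [e]
    exact eLpNorm_le_eLpNorm_of_exponent_le h2
      ((measurable_quadSum k _).aestronglyMeasurable.sub hM)

lemma quadConverges_ae {H : ℝ} (hH : 1 / 4 < H) : ∀ᵐ z ∂muH H, QuadConverges z :=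
  ae_all_iff.mpr fun k => (quadB_converges hH k).1

/-- Fatou's lemma along the Galerkin sums, whose variances are all below the full series. -/
lemma lintegral_quadB_le {H : ℝ} (hH : 1 / 4 < H) (k : ℤ × ℤ) {W : ℝ} (hW : 0 < W)
    (hV : ∑' h, termVar H k h ≤ W) (m : ℕ) :
    ∫⁻ z, ‖quadB z k‖ₑ ^ (2 * m) ∂muH H ≤ ENNReal.ofReal (momentConst m * W ^ m) := by
  have hb : ∀ N, ∫⁻ z, ‖quadSum k (ball k N) z‖ₑ ^ (2 * m) ∂muH H ≤
      ENNReal.ofReal (momentConst m * W ^ m) := fun N =>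
    lintegral_quadSum_le H k _ hW ((quadVar_le H k _).trans
      (((summable_termVar hH k).sum_le_tsum _ fun h _ => termVar_nonneg H k h).trans hV)) m
  calc ∫⁻ z, ‖quadB z k‖ₑ ^ (2 * m) ∂muH H
      = ∫⁻ z, liminf (fun N => ‖quadSum k (ball k N) z‖ₑ ^ (2 * m)) atTop ∂muH H := by
        refine lintegral_congr_ae ?_
        filter_upwards [(quadB_converges hH k).1] with z hz
        have h1 := ((ENNReal.continuous_pow (2 * m)).tendsto _).comp hz.enorm
        refine h1.liminf_eq.symm.trans (congrArg (fun g => liminf g atTop) ?_)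
        ext N
        simp only [Function.comp, bil_galerkin, enorm_mul]
        simp [← ofReal_norm]
    _ ≤ liminf (fun N => ∫⁻ z, ‖quadSum k (ball k N) z‖ₑ ^ (2 * m) ∂muH H) atTop :=
        lintegral_liminf_le fun N => (measurable_quadSum k _).enorm.pow_const _
    _ ≤ _ := liminf_le_of_frequently_le' (Frequently.of_forall hb)

lemma muH_ae_reflect (H : ℝ) :
    ∀ᵐ z ∂muH H, z 0 = 0 ∧ ∀ k, z (-k) = -(starRingEnd ℂ) (z k) := by
  rw [muH_eq]
  refine (ae_map_iff measurable_assemble.aemeasurable ?_).mpr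
    (ae_of_all _ fun y => ⟨reflect_zero _, reflect_neg _⟩)
  refine MeasurableSet.inter ?_ ?_
  · exact measurableSet_eq_fun (measurable_pi_apply 0) measurable_const
  · have : {z : Coeff | ∀ k, z (-k) = -(starRingEnd ℂ) (z k)} =
        ⋂ k, {z : Coeff | z (-k) = -(starRingEnd ℂ) (z k)} := by ext; simp
    change MeasurableSet {z : Coeff | ∀ k, z (-k) = -(starRingEnd ℂ) (z k)}
    rw [this]
    exact MeasurableSet.iInter fun k => measurableSet_eq_fun (measurable_pi_apply _)
      (Complex.continuous_conj.measurable.comp (measurable_pi_apply k)).neg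

lemma gam_neg_neg (h k : ℤ × ℤ) : gam (-h) (-k) = gam h k := by
  have e : -k - -h = -(k - h) := by abel
  simp only [gam, len_neg, e, Prod.fst_neg, Prod.snd_neg]
  ring_nf

lemma quadB_zero (z : Coeff) : quadB z 0 = 0 := by
  have h : ∀ N, bil (galerkin N z) (galerkin N z) 0 = 0 := fun N => by simp [bil, gam]
  simp only [quadB, h]
  exact tendsto_const_nhds.limUnder_eq

/-- The change of variable h ↦ -h preserves the truncation and `gam`, so the symmetry holds at each
level N and passes to the limit. -/
lemma quadB_neg {z : Coeff} (hz : ∀ k, z (-k) = -(starRingEnd ℂ) (z k)) (hc : QuadConverges z)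
    (k : ℤ × ℤ) : quadB z (-k) = -(starRingEnd ℂ) (quadB z k) := by
  have h1 := hc (-k)
  have h2 := ((Complex.continuous_conj.tendsto _).comp (hc k)).neg
  refine tendsto_nhds_unique h1 (h2.congr fun N => ?_)
  simp only [Function.comp, bil_galerkin, quadSum, map_mul, map_sum, Complex.conj_I, neg_mul,
    neg_neg, Complex.conj_ofReal]
  congr 1
  refine Finset.sum_nbij' (fun h => -h) (fun h => -h) ?_ ?_ (fun _ _ => neg_neg _)
    (fun _ _ => neg_neg _) fun h _ => ?_
  · intro h hh
    rw [mem_ball] at hh ⊢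
    rwa [len_neg, neg_sub_neg, len_sub_comm]
  · intro h hh
    rw [mem_ball] at hh ⊢
    have e : k - -h = -(-k - h) := by abel
    rwa [len_neg, e, len_neg]
  · have e : -k - -h = -(k - h) := by abel
    rw [gam_neg_neg, e, hz, hz]; ring

/-! ### `B(z,z)` as an `H^ρ`-valued random variable -/

/-- An upper bound for the variance of `B_k(z,z)` that is positive for `k ≠ 0`. -/
def modeVar (H ρ : ℝ) (k : ℤ × ℤ) : ℝ := ∑' h, termVar H k h + len k ^ (-(2 * ρ) - 3)

lemma modeVar_pos (H ρ : ℝ) {k : ℤ × ℤ} (hk : k ≠ 0) : 0 < modeVar H ρ k :=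
  add_pos_of_nonneg_of_pos (tsum_nonneg fun h => termVar_nonneg H k h)
    (Real.rpow_pos_of_pos (len_pos hk) _)

/-- The factor |k|² from γ² shifts the weight to s = 2ρ + 2, and the conditions of
`summable_lattice` with a = 4H become those on ρ. The term added for positivity contributes
|k|^{-3}. -/
lemma summable_modeVar {H ρ : ℝ} (hH : 1 / 4 < H) (hρ : H < 1 / 2 → ρ < 4 * H - 3)
    (hρ' : 1 / 2 ≤ H → ρ < 2 * (H - 1)) :
    Summable fun k : {k : ℤ × ℤ // k ≠ 0} => len k ^ (2 * ρ) * modeVar H ρ k := by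
  have h1 := (summable_lattice (a := 4 * H) (s := 2 * ρ + 2) (by linarith)
    (fun h => by linarith [hρ (by linarith)]) (fun h => by linarith [hρ' (by linarith)])).prod
  have h2 := (h1.mul_left (max (constC H) 0 ^ 2 + 1)).add (summable_len_rpow (q := 3) (by norm_num))
  refine (h2.comp_injective (i := fun k : {k : ℤ × ℤ // k ≠ 0} => (k : ℤ × ℤ))
    Subtype.val_injective).congr fun k => ?_
  have hk := len_pos k.2
  simp only [Function.comp, if_neg k.2, modeVar, termVar, varConst, tsum_mul_left]
  rw [mul_add, ← Real.rpow_add hk]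
  congr 1
  · rw [Real.rpow_add hk (2 * ρ) 2, Real.rpow_two]; ring
  · congr 1; ring

lemma normH_pow (r : ℝ) (v : Coeff) (n : ℕ) : normH r v ^ (2 * n) =
    (∑' k : {k : ℤ × ℤ // k ≠ 0}, ENNReal.ofReal (len k ^ (2 * r) * ‖v k‖ ^ 2)) ^ n := by
  rw [normH, pow_mul]
  congr 1
  rw [← ENNReal.rpow_natCast, ← ENNReal.rpow_mul]
  norm_num

lemma measurable_normH (r : ℝ) : Measurable (normH r) := by
  unfold normH
  refine Measurable.pow_const (Measurable.tsum fun k => ?_) _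
  exact (((measurable_pi_apply (k : ℤ × ℤ)).norm.pow_const 2).const_mul _).ennreal_ofReal

lemma measurable_quadB_pi : Measurable quadB := measurable_pi_lambda _ measurable_quadB

lemma lintegral_normH_quadB_lt_top {H ρ : ℝ} (hH : 1 / 4 < H) (hρ : H < 1 / 2 → ρ < 4 * H - 3)
    (hρ' : 1 / 2 ≤ H → ρ < 2 * (H - 1)) (m : ℕ) :
    ∫⁻ z, normH ρ (quadB z) ^ (2 * m) ∂muH H < ∞ := by
  rcases m with _ | n
  · simp
  simp only [normH_pow]
  refine lintegral_tsum_pow_lt_top (fun k => ?_) (summable_modeVar hH hρ hρ') (fun k => ?_)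
    (c := momentConst (n + 1)) fun k => ?_
  · exact mul_pos (Real.rpow_pos_of_pos (len_pos k.2) _) (modeVar_pos H ρ k.2)
  · exact ((((measurable_quadB k).norm.pow_const 2).const_mul _).ennreal_ofReal).aemeasurable
  · have h1 := lintegral_quadB_le hH k (modeVar_pos H ρ k.2)
      (le_add_of_nonneg_right (Real.rpow_nonneg (len_nonneg _) _)) (n + 1)
    have e : ∀ z : Coeff, ENNReal.ofReal (len k ^ (2 * ρ) * ‖quadB z k‖ ^ 2) ^ (n + 1) =
        ENNReal.ofReal ((len k ^ (2 * ρ)) ^ (n + 1)) * ‖quadB z k‖ₑ ^ (2 * (n + 1)) := fun z => by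
      rw [ENNReal.ofReal_mul (len_rpow_nonneg _ _), mul_pow, ENNReal.ofReal_pow (len_rpow_nonneg _ _),
        ENNReal.ofReal_pow (norm_nonneg _), ofReal_norm, ← pow_mul]
    simp only [e]
    rw [lintegral_const_mul' _ _ ENNReal.ofReal_ne_top]
    refine (mul_le_mul_right h1 _).trans (le_of_eq ?_)
    rw [← ENNReal.ofReal_mul (pow_nonneg (len_rpow_nonneg _ _) _)]
    congr 1
    rw [mul_pow]; ring

lemma lintegral_normH_quadB_rpow_lt_top {H ρ : ℝ} (hH : 1 / 4 < H)
    (hρ : H < 1 / 2 → ρ < 4 * H - 3) (hρ' : 1 / 2 ≤ H → ρ < 2 * (H - 1)) {p : ℝ} (hp : 0 ≤ p) :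
    ∫⁻ z, normH ρ (quadB z) ^ p ∂muH H < ∞ := by
  obtain ⟨m, hm⟩ := exists_nat_ge p
  have h1 : ∀ x : ℝ≥0∞, x ^ p ≤ 1 + x ^ (2 * m) := fun x => by
    rcases le_total x 1 with hx | hx
    · exact (ENNReal.rpow_le_one hx hp).trans le_self_add
    · refine le_trans ?_ le_add_self
      rw [← ENNReal.rpow_natCast]
      refine ENNReal.rpow_le_rpow_of_exponent_le hx ?_
      push_cast
      linarith [Nat.cast_nonneg (α := ℝ) m]
  calc _ ≤ ∫⁻ z, (1 + normH ρ (quadB z) ^ (2 * m)) ∂muH H := lintegral_mono fun z => h1 _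
    _ < ∞ := by
      rw [lintegral_add_left measurable_const]
      simpa using lintegral_normH_quadB_lt_top hH hρ hρ' m

lemma memH_of_normH_lt_top {r : ℝ} {v : Coeff} (h0 : v 0 = 0)
    (hneg : ∀ k, v (-k) = -(starRingEnd ℂ) (v k)) (h : normH r v ^ 2 < ∞) : MemH r v := by
  refine ⟨h0, hneg, ?_⟩
  have h1 := normH_pow r v 1
  rw [mul_one, pow_one] at h1
  rw [h1] at h
  have h2 := ENNReal.summable_toReal h.ne
  refine h2.congr fun k => ?_
  rw [ENNReal.toReal_ofReal (mul_nonneg (len_rpow_nonneg _ _) (by positivity))]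

lemma memH_quadB_ae {H ρ : ℝ} (hH : 1 / 4 < H) (hρ : H < 1 / 2 → ρ < 4 * H - 3)
    (hρ' : 1 / 2 ≤ H → ρ < 2 * (H - 1)) : ∀ᵐ z ∂muH H, MemH ρ (quadB z) := by
  have h1 := lintegral_normH_quadB_lt_top hH hρ hρ' 1
  have hmeas : Measurable fun z => normH ρ (quadB z) ^ (2 * 1) :=
    ((measurable_normH ρ).comp measurable_quadB_pi).pow_const _
  filter_upwards [ae_lt_top hmeas h1.ne, quadConverges_ae hH, muH_ae_reflect H] with z hz hc hr
  exact memH_of_normH_lt_top (quadB_zero z) (quadB_neg hr.2 hc) (by simpa using hz)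

/-! ### Pathwise Riemann–Stieltjes integrals -/

section Stieltjes

variable {f f' g : ℝ → ℝ} {a c : ℝ}

/-- The difference is ∫ f'(g - q), and f' ≥ 0 has integral f(w) - f(u). -/
lemma abs_integral_deriv_mul_sub_le (hf : ∀ x, HasDerivAt f (f' x) x) (hf' : Continuous f')
    (h0 : ∀ x, 0 ≤ f' x) (hg : Continuous g) {u w q ε : ℝ} (huw : u ≤ w)
    (hq : ∀ s ∈ Icc u w, |g s - q| ≤ ε) :
    |(∫ s in u..w, f' s * g s) - q * (f w - f u)| ≤ ε * (f w - f u) := by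
  have hint : ∫ s in u..w, f' s = f w - f u :=
    intervalIntegral.integral_eq_sub_of_hasDerivAt (fun x _ => hf x)
      (hf'.intervalIntegrable u w)
  have e : (∫ s in u..w, f' s * g s) - q * (f w - f u) = ∫ s in u..w, f' s * (g s - q) := by
    rw [← hint, ← intervalIntegral.integral_const_mul, ← intervalIntegral.integral_sub]
    · congr 1; ext s; ring
    · exact (hf'.mul hg).intervalIntegrable u w
    · exact (hf'.const_mul q).intervalIntegrable u w
  rw [e, ← hint, ← intervalIntegral.integral_const_mul, ← Real.norm_eq_abs]
  refine intervalIntegral.norm_integral_le_of_norm_le huw (ae_of_all _ fun s hs => ?_)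
    ((hf'.const_mul ε).intervalIntegrable u w)
  rw [Real.norm_eq_abs, abs_mul, abs_of_nonneg (h0 s), mul_comm]
  exact mul_le_mul_of_nonneg_right (hq s ⟨hs.1.le, hs.2⟩) (h0 s)

/-- Integration by parts: a monotone `C¹` integrand has a Riemann–Stieltjes integral against a
continuous integrator. -/
lemma hasStieltjes_of_hasDerivAt (hf : ∀ x, HasDerivAt f (f' x) x) (hf' : Continuous f')
    (h0 : ∀ x, 0 ≤ f' x) (hg : Continuous g) :
    HasStieltjes f g a c (f c * g c - f a * g a - ∫ s in a..c, f' s * g s) := by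
  intro ε hε
  have hfg : Continuous fun s => f' s * g s := hf'.mul hg
  -- The added 1 keeps the divisor positive when f(c) = f(a).
  set K : ℝ := |f c - f a| + 1 with hK
  have hK0 : 0 < K := by positivity
  obtain ⟨δ, hδ, hgδ⟩ := Metric.uniformContinuousOn_iff.mp
    ((isCompact_Icc (a := a) (b := c)).uniformContinuousOn_of_continuous hg.continuousOn)
    (ε / K) (by positivity)
  refine ⟨δ, hδ, fun n x ξ hx0 hxn hx => ?_⟩
  have hstep : ∀ i < n, x i ≤ x (i + 1) := fun i hi => (hx i hi).1.trans (hx i hi).2.1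
  have hle : ∀ j, j ≤ n → ∀ i ≤ j, x i ≤ x j := by
    intro j hj i hij
    induction j, hij using Nat.le_induction with
    | base => exact le_rfl
    | succ j _ ih => exact (ih (by omega)).trans (hstep j (by omega))
  have hmem : ∀ i ≤ n, a ≤ x i ∧ x i ≤ c := fun i hi =>
    ⟨hx0 ▸ hle i hi 0 (Nat.zero_le _), hxn ▸ hle n le_rfl i hi⟩
  have hosc : ∀ i < n, ∀ s ∈ Icc (x i) (x (i + 1)), ∀ q ∈ Icc (x i) (x (i + 1)),
      |g s - g q| ≤ ε / K := by
    intro i hi s hs q hq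
    have h1 := hmem i hi.le
    have h2 := hmem (i + 1) hi
    refine (hgδ s ⟨h1.1.trans hs.1, hs.2.trans h2.2⟩ q ⟨h1.1.trans hq.1, hq.2.trans h2.2⟩ ?_).le
    rw [Real.dist_eq, abs_lt]
    have := (hx i hi).2.2
    constructor <;> linarith [hs.1, hs.2, hq.1, hq.2]
  -- The error on a cell is ∫ f'(g - g(x_i)) up to the tag plus ∫ f'(g - g(x_{i+1})) after it, at
  -- most the oscillation of g times the increment of f. These increments telescope.
  have hterm : ∀ i < n, |f (ξ i) * (g (x (i + 1)) - g (x i)) -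
      ((f (x (i + 1)) * g (x (i + 1)) - f (x i) * g (x i)) -
        ∫ s in (x i)..(x (i + 1)), f' s * g s)| ≤ ε / K * (f (x (i + 1)) - f (x i)) := by
    intro i hi
    obtain ⟨h1, h2, -⟩ := hx i hi
    have k1 := abs_integral_deriv_mul_sub_le hf hf' h0 hg h1 fun s hs =>
      hosc i hi s ⟨hs.1, hs.2.trans h2⟩ (x i) ⟨le_rfl, h1.trans h2⟩
    have k2 := abs_integral_deriv_mul_sub_le hf hf' h0 hg h2 fun s hs =>
      hosc i hi s ⟨h1.trans hs.1, hs.2⟩ (x (i + 1)) ⟨h1.trans h2, le_rfl⟩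
    have hadd := intervalIntegral.integral_add_adjacent_intervals (μ := volume)
      (hfg.intervalIntegrable (x i) (ξ i)) (hfg.intervalIntegrable (ξ i) (x (i + 1)))
    rw [← hadd]
    rw [abs_le] at k1 k2 ⊢
    constructor <;> nlinarith [k1.1, k1.2, k2.1, k2.2]
  have htel : f c * g c - f a * g a - ∫ s in a..c, f' s * g s =
      ∑ i ∈ Finset.range n, ((f (x (i + 1)) * g (x (i + 1)) - f (x i) * g (x i)) -
        ∫ s in (x i)..(x (i + 1)), f' s * g s) := by
    rw [Finset.sum_sub_distrib, Finset.sum_range_sub fun i => f (x i) * g (x i),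
      intervalIntegral.sum_integral_adjacent_intervals fun i _ =>
        hfg.intervalIntegrable _ _, hx0, hxn]
  rw [htel, ← Finset.sum_sub_distrib]
  refine (Finset.abs_sum_le_sum_abs _ _).trans_lt ?_
  refine (Finset.sum_le_sum fun i hi => hterm i (Finset.mem_range.mp hi)).trans_lt ?_
  rw [← Finset.mul_sum, Finset.sum_range_sub fun i => f (x i), hx0, hxn, div_mul_eq_mul_div,
    div_lt_iff₀ hK0]
  have := le_abs_self (f c - f a)
  exact mul_lt_mul_of_pos_left (by linarith) hε

/-- The left Riemann–Stieltjes sum over the uniform partition into `n + 1` intervals. -/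
def unifSum (f g : ℝ → ℝ) (a c : ℝ) (n : ℕ) : ℝ :=
  ∑ i ∈ Finset.range (n + 1), f (a + i * ((c - a) / (n + 1))) *
    (g (a + (i + 1 : ℕ) * ((c - a) / (n + 1))) - g (a + i * ((c - a) / (n + 1))))

/-- A fixed sequence of sums reaching the integral gives its uniqueness, and later its measurability
and Gaussian law. -/
lemma HasStieltjes.tendsto_unifSum {I : ℝ} (h : HasStieltjes f g a c I) (hac : a ≤ c) :
    Tendsto (unifSum f g a c) atTop (𝓝 I) := by
  rw [Metric.tendsto_atTop]
  intro ε hε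
  obtain ⟨δ, hδ, hI⟩ := h ε hε
  obtain ⟨N, hN⟩ := exists_nat_gt ((c - a) / δ)
  refine ⟨N, fun n hn => ?_⟩
  have hn1 : (0 : ℝ) < n + 1 := by positivity
  have hmesh : (c - a) / (n + 1) < δ := by
    rw [div_lt_iff₀ hδ] at hN
    rw [div_lt_iff₀ hn1]
    have : (N : ℝ) ≤ n := by exact_mod_cast hn
    nlinarith
  have hpos : 0 ≤ (c - a) / (n + 1) := div_nonneg (by linarith) hn1.le
  rw [Real.dist_eq]
  refine hI (n + 1) (fun i => a + i * ((c - a) / (n + 1))) (fun i => a + i * ((c - a) / (n + 1)))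
    (by simp) (by push_cast; field_simp; ring) fun i _ => ⟨le_rfl, ?_, ?_⟩
  · push_cast; nlinarith
  · push_cast; nlinarith

lemma HasStieltjes.stieltjes_eq {I : ℝ} (h : HasStieltjes f g a c I) (hac : a ≤ c) :
    stieltjes f g a c = I :=
  tendsto_nhds_unique
    (HasStieltjes.tendsto_unifSum (Classical.epsilon_spec (p := HasStieltjes f g a c) ⟨I, h⟩) hac)
    (h.tendsto_unifSum hac)

end Stieltjes

/-- The paths for which the stationary convolution with `e^{-λ·}` is given by integration by
parts. -/
structure GoodPath (lam : ℝ) (g : ℝ → ℝ) : Prop where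
  continuous : Continuous g
  integrable : IntegrableOn (fun s => Real.exp (lam * s) * g s) (Iic 0)
  decay : Tendsto (fun n : ℕ => Real.exp (-(lam * n)) * g (-(n : ℝ))) atTop (𝓝 0)

/-- The stationary convolution, integrated by parts. -/
def partsConv (lam : ℝ) (g : ℝ → ℝ) (t : ℝ) : ℝ :=
  g t - ∫ s in Iic t, lam * Real.exp (-(lam * (t - s))) * g s

lemma GoodPath.integrableOn_Iic {lam : ℝ} {g : ℝ → ℝ} (h : GoodPath lam g) (t : ℝ) :
    IntegrableOn (fun s => lam * Real.exp (-(lam * (t - s))) * g s) (Iic t) := by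
  have h1 : IntegrableOn (fun s => Real.exp (lam * s) * g s) (Iic t) := by
    have hc : Continuous fun s => Real.exp (lam * s) * g s := by
      have := h.continuous
      fun_prop
    refine (h.integrable.union (hc.integrableOn_Icc (a := 0) (b := t))).mono_set fun s hs => ?_
    rcases le_total s 0 with h0 | h0
    · exact Or.inl h0
    · exact Or.inr ⟨h0, hs⟩
  refine (h1.const_mul (lam * Real.exp (-(lam * t)))).congr (ae_of_all _ fun s => ?_)
  simp only
  rw [show -(lam * (t - s)) = -(lam * t) + lam * s by ring, Real.exp_add]
  ring

lemma hasStieltjes_exp {lam : ℝ} (hlam : 0 ≤ lam) {g : ℝ → ℝ} (hg : Continuous g) (t a : ℝ) :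
    HasStieltjes (fun s => Real.exp (-(lam * (t - s)))) g a t
      (g t - Real.exp (-(lam * (t - a))) * g a -
        ∫ s in a..t, lam * Real.exp (-(lam * (t - s))) * g s) := by
  have hd : ∀ x, HasDerivAt (fun s => Real.exp (-(lam * (t - s))))
      (lam * Real.exp (-(lam * (t - x)))) x := fun x => by
    have h1 : HasDerivAt (fun s => -(lam * (t - s))) lam x := by
      have := (((hasDerivAt_id x).const_sub t).const_mul lam).fun_neg
      simpa using this
    simpa [mul_comm] using h1.exp
  have := hasStieltjes_of_hasDerivAt (a := a) (c := t) hd (by fun_prop)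
    (fun x => by positivity) hg
  simpa using this

lemma GoodPath.tendsto_stieltjes {lam : ℝ} (hlam : 0 ≤ lam) {g : ℝ → ℝ} (h : GoodPath lam g)
    (t : ℝ) :
    Tendsto (fun n : ℕ => stieltjes (fun s => Real.exp (-(lam * (t - s)))) g (-(n : ℝ)) t) atTop
      (𝓝 (partsConv lam g t)) := by
  have h1 : Tendsto (fun n : ℕ => g t - Real.exp (-(lam * (t - -(n : ℝ)))) * g (-(n : ℝ)) -
      ∫ s in (-(n : ℝ))..t, lam * Real.exp (-(lam * (t - s))) * g s) atTop
      (𝓝 (partsConv lam g t)) := by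
    refine Tendsto.sub ?_ (intervalIntegral_tendsto_integral_Iic t (h.integrableOn_Iic t)
      (tendsto_neg_atTop_atBot.comp tendsto_natCast_atTop_atTop))
    have h2 := (h.decay.const_mul (Real.exp (-(lam * t)))).const_sub (g t)
    rw [mul_zero, sub_zero] at h2
    refine h2.congr fun n => ?_
    rw [← mul_assoc, ← Real.exp_add]
    ring_nf
  refine h1.congr' ?_
  obtain ⟨N, hN⟩ := exists_nat_ge (-t)
  filter_upwards [eventually_ge_atTop N] with n hn
  have : (N : ℝ) ≤ n := by exact_mod_cast hn
  exact ((hasStieltjes_exp hlam h.continuous t _).stieltjes_eq (by linarith)).symm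

lemma GoodPath.expConv_eq {lam : ℝ} (hlam : 0 ≤ lam) {g : ℝ → ℝ} (h : GoodPath lam g) (t : ℝ) :
    expConv lam g t = partsConv lam g t :=
  (h.tendsto_stieltjes hlam t).limUnder_eq

lemma integral_Iic_eq_integral_Ioi (F : ℝ → ℝ) (t : ℝ) :
    ∫ s in Iic t, F s = ∫ r in Ioi (0 : ℝ), F (t - r) := by
  rw [← integral_Ici_eq_integral_Ioi]
  have h := (Measure.measurePreserving_sub_left (volume : Measure ℝ) t).setIntegral_preimage_emb
    (MeasurableEquiv.subLeft t).measurableEmbedding F (Iic t)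
  rw [← h]
  congr 2
  ext r
  simp

lemma integrableOn_Iic_iff_Ioi (F : ℝ → ℝ) (t : ℝ) :
    IntegrableOn F (Iic t) ↔ IntegrableOn (fun r => F (t - r)) (Ioi 0) := by
  rw [← integrableOn_Ici_iff_integrableOn_Ioi]
  have h := (Measure.measurePreserving_sub_left (volume : Measure ℝ) t).integrableOn_comp_preimage
    (MeasurableEquiv.subLeft t).measurableEmbedding (f := F) (s := Iic t)
  rw [← h]
  have e : (fun r => t - r) ⁻¹' Iic t = Ici 0 := by ext r; simp
  rw [e]
  rfl

lemma integral_exp_weight {lam : ℝ} (hlam : 0 < lam) :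
    IntegrableOn (fun r => lam * Real.exp (-(lam * r))) (Ioi 0) ∧
      ∫ r in Ioi (0 : ℝ), lam * Real.exp (-(lam * r)) = 1 := by
  have h1 := integrableOn_exp_mul_Ioi (a := -lam) (by linarith) 0
  have h2 := integral_exp_mul_Ioi (a := -lam) (by linarith) 0
  simp only [neg_mul] at h1 h2
  refine ⟨h1.const_mul lam, ?_⟩
  rw [integral_const_mul, h2]
  simp [hlam.ne']

/-- The weight λ e^{-λr} has mass 1, so g(t) can be moved under the integral. Only increments
remain, and their covariance does not depend on t. -/
lemma GoodPath.partsConv_eq {lam : ℝ} (hlam : 0 < lam) {g : ℝ → ℝ} (h : GoodPath lam g) (t : ℝ) :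
    partsConv lam g t =
      ∫ r in Ioi (0 : ℝ), lam * Real.exp (-(lam * r)) * (g t - g (t - r)) := by
  obtain ⟨w1, w2⟩ := integral_exp_weight hlam
  have h1 := integral_Iic_eq_integral_Ioi
    (fun s => lam * Real.exp (-(lam * (t - s))) * g s) t
  simp only [sub_sub_cancel] at h1
  have h2 : IntegrableOn (fun r => lam * Real.exp (-(lam * r)) * g (t - r)) (Ioi 0) := by
    have := (integrableOn_Iic_iff_Ioi _ t).mp (h.integrableOn_Iic t)
    simpa only [sub_sub_cancel] using this
  simp only [mul_sub]
  rw [integral_sub (w1.mul_const _) h2, integral_mul_const, w2, one_mul, partsConv, h1]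

/-! ### Almost sure limits of centred Gaussian functionals -/

section GaussianLimits

variable {Ω : Type*} [MeasurableSpace Ω] {P : Measure Ω}

lemma charFun_map_real {Y : Ω → ℝ} (hY : AEMeasurable Y P) (t : ℝ) :
    charFun (P.map Y) t = ∫ ω, Complex.exp (t * Y ω * Complex.I) ∂P := by
  rw [charFun_apply_real, integral_map hY (by fun_prop)]

/-- Characteristic functions converge by dominated convergence. A nonzero value of the limit at one
point determines the limit of the variances, hence the whole limit. -/
lemma exists_gaussianReal_of_tendsto [IsProbabilityMeasure P] {Y : ℕ → Ω → ℝ} {Z : Ω → ℝ} (hY : ∀ n, AEMeasurable (Y n) P)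
    (hZ : AEMeasurable Z P) (hlaw : ∀ n, ∃ v, P.map (Y n) = gaussianReal 0 v)
    (hlim : ∀ᵐ ω ∂P, Tendsto (fun n => Y n ω) atTop (𝓝 (Z ω))) :
    ∃ v, P.map Z = gaussianReal 0 v := by
  choose v hv using hlaw
  have hchar : ∀ n (t : ℝ), charFun (P.map (Y n)) t = (Real.exp (-(v n * t ^ 2 / 2)) : ℝ) := by
    intro n t
    rw [hv, charFun_gaussianReal]
    push_cast
    congr 1
    simp
  have hconv : ∀ t : ℝ, Tendsto (fun n => charFun (P.map (Y n)) t) atTop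
      (𝓝 (charFun (P.map Z) t)) := by
    intro t
    simp only [charFun_map_real hZ, charFun_map_real (hY _)]
    refine tendsto_integral_of_dominated_convergence (fun _ => 1) (fun n => ?_)
      (integrable_const _) (fun n => ae_of_all _ fun ω => ?_) ?_
    · have := hY n
      exact (by fun_prop : AEMeasurable (fun ω => Complex.exp (t * Y n ω * Complex.I)) P)
        |>.aestronglyMeasurable
    · rw [show (t * Y n ω * Complex.I : ℂ) = ((t * Y n ω : ℝ) : ℂ) * Complex.I by push_cast; ring,
        Complex.norm_exp_ofReal_mul_I]
    · filter_upwards [hlim] with ω hω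
      have h1 : Continuous fun y : ℝ => Complex.exp (t * y * Complex.I) := by fun_prop
      exact (h1.tendsto _).comp hω
  have := Measure.isProbabilityMeasure_map (μ := P) hZ
  -- Continuity at 0, where the characteristic function is 1, provides such a point; it rules out
  -- variances escaping to infinity.
  obtain ⟨t₀, ht₀, hne⟩ : ∃ t : ℝ, t ≠ 0 ∧ charFun (P.map Z) t ≠ 0 := by
    have hc : ContinuousAt (charFun (P.map Z)) 0 := continuous_charFun.continuousAt
    have h0 : charFun (P.map Z) 0 ≠ 0 := by simp
    have hev := (hc.eventually_ne h0).filter_mono (nhdsWithin_le_nhds (s := {0}ᶜ))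
    obtain ⟨t, ht, ht'⟩ := (hev.and self_mem_nhdsWithin).exists
    exact ⟨t, ht', ht⟩
  set L := ‖charFun (P.map Z) t₀‖ with hL
  have hL0 : 0 < L := norm_pos_iff.mpr hne
  have hLlim : Tendsto (fun n => Real.exp (-(v n * t₀ ^ 2 / 2))) atTop (𝓝 L) := by
    have := (hconv t₀).norm
    simpa only [hchar, Complex.norm_real, Real.norm_eq_abs, Real.abs_exp] using this
  have hvlim : Tendsto (fun n => (v n : ℝ)) atTop (𝓝 (-(2 * Real.log L) / t₀ ^ 2)) := by
    have h1 := (Real.continuousAt_log hL0.ne').tendsto.comp hLlim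
    refine (((h1.const_mul 2).neg).div_const (t₀ ^ 2)).congr fun n => ?_
    simp only [Function.comp, Real.log_exp]
    field_simp
  set V : ℝ := -(2 * Real.log L) / t₀ ^ 2 with hV
  have hV0 : 0 ≤ V := ge_of_tendsto' hvlim fun n => (v n).coe_nonneg
  refine ⟨V.toNNReal, Measure.ext_of_charFun ?_⟩
  ext t
  refine tendsto_nhds_unique (hconv t) ?_
  rw [charFun_gaussianReal, Real.coe_toNNReal V hV0]
  simp only [hchar]
  have h2 : Tendsto (fun n => Real.exp (-(v n * t ^ 2 / 2))) atTop
      (𝓝 (Real.exp (-(V * t ^ 2 / 2)))) :=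
    (Real.continuous_exp.tendsto _).comp ((hvlim.mul_const _).div_const 2).neg
  have h3 := (Complex.continuous_ofReal.tendsto _).comp h2
  have e : Complex.exp (t * (0 : ℝ) * Complex.I - V * t ^ 2 / 2) =
      (Real.exp (-(V * t ^ 2 / 2)) : ℝ) := by
    push_cast
    congr 1
    simp
  rw [e]
  exact h3

/-- `Y` is almost surely a measurable functional of the path of `X` and has a centred Gaussian
law. -/
structure IsGaussianFunctional (X : ℝ → Ω → ℝ) (P : Measure Ω) (Y : Ω → ℝ) : Prop where
  functional : ∃ Φ : (ℝ → ℝ) → ℝ, Measurable Φ ∧ Y =ᵐ[P] fun ω => Φ fun s => X s ω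
  law : ∃ v, P.map Y = gaussianReal 0 v

lemma IsGaussianFunctional.aemeasurable {X : ℝ → Ω → ℝ} {Y : Ω → ℝ} (hX : ∀ t, Measurable (X t))
    (h : IsGaussianFunctional X P Y) : AEMeasurable Y P := by
  obtain ⟨Φ, hΦ, e⟩ := h.functional
  exact ⟨_, hΦ.comp (measurable_pi_lambda _ hX), e⟩

/-- Keeping a measurable functional of the path, and not only the law, is what later carries
independence of the driving paths over to the modes. -/
lemma IsGaussianFunctional.of_tendsto [IsProbabilityMeasure P] {X : ℝ → Ω → ℝ} (hX : ∀ t, Measurable (X t))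
    {Y : ℕ → Ω → ℝ} {Z : Ω → ℝ} (h : ∀ n, IsGaussianFunctional X P (Y n))
    (hlim : ∀ᵐ ω ∂P, Tendsto (fun n => Y n ω) atTop (𝓝 (Z ω))) :
    IsGaussianFunctional X P Z := by
  have hY := fun n => (h n).aemeasurable hX
  have hZ : AEMeasurable Z P := aemeasurable_of_tendsto_metrizable_ae atTop hY hlim
  refine ⟨?_, exists_gaussianReal_of_tendsto hY hZ (fun n => (h n).law) hlim⟩
  choose Φ hΦ e using fun n => (h n).functional
  refine ⟨fun g => limUnder atTop fun n => Φ n g,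
    (StronglyMeasurable.limUnder fun n => (hΦ n).stronglyMeasurable).measurable, ?_⟩
  filter_upwards [hlim, ae_all_iff.mpr e] with ω h1 h2
  simp only [h2] at h1
  exact h1.limUnder_eq.symm

lemma isGaussianFunctional_unifSum [IsProbabilityMeasure P] {H : ℝ} {X : ℝ → Ω → ℝ} (hX : IsFBM H X P) (f : ℝ → ℝ)
    (a c : ℝ) (n : ℕ) : IsGaussianFunctional X P fun ω => unifSum f (fun s => X s ω) a c n := by
  refine ⟨⟨fun g => unifSum f g a c n, by unfold unifSum; fun_prop, ae_of_all _ fun ω => rfl⟩, ?_⟩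
  let p : ℕ → ℝ := fun i => a + i * ((c - a) / (n + 1))
  let Z : ℕ → Ω → ℝ := fun i ω => f (p i) * (X (p (i + 1)) ω - X (p i) ω)
  have hint : ∀ t, Integrable (X t) P := fun t => (hX.gaussian.hasGaussianLaw_eval t).integrable
  have hZ : IsGaussianProcess Z P := by
    refine hX.gaussian.of_isGaussianProcess fun i => ?_
    refine ⟨{p i, p (i + 1)}, f (p i) • (ContinuousLinearMap.proj (R := ℝ) (φ := fun _ => ℝ)
      (⟨p (i + 1), by simp⟩ : ({p i, p (i + 1)} : Finset ℝ)) -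
      ContinuousLinearMap.proj (R := ℝ) (φ := fun _ => ℝ) (⟨p i, by simp⟩ : ({p i, p (i + 1)} : Finset ℝ))), fun ω => ?_⟩
    simp [Z]
  have hG : HasGaussianLaw (fun ω => ∑ i ∈ Finset.range (n + 1), Z i ω) P :=
    hZ.hasGaussianLaw_fun_sum
  have e : (fun ω => unifSum f (fun s => X s ω) a c n) =
      fun ω => ∑ i ∈ Finset.range (n + 1), Z i ω := rfl
  have hmean : ∫ ω, ∑ i ∈ Finset.range (n + 1), Z i ω ∂P = 0 := by
    have hZint : ∀ i, Integrable (Z i) P := fun i => ((hint _).sub (hint _)).const_mul _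
    rw [integral_finsetSum _ fun i _ => hZint i]
    refine Finset.sum_eq_zero fun i _ => ?_
    simp only [Z]
    rw [integral_const_mul, integral_sub (hint _) (hint _), hX.centered, hX.centered]
    simp
  rw [e, hG.map_eq_gaussianReal, hmean]
  exact ⟨_, rfl⟩

lemma isGaussianFunctional_expConv [IsProbabilityMeasure P] {H lam t : ℝ} (hlam : 0 ≤ lam) {X : ℝ → Ω → ℝ}
    (hX : IsFBM H X P) (hgood : ∀ᵐ ω ∂P, GoodPath lam fun s => X s ω) :
    IsGaussianFunctional X P fun ω => expConv lam (fun s => X s ω) t := by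
  -- The shift by N ensures -(n + N) ≤ t, so that the Stieltjes integral is uniquely determined.
  obtain ⟨N, hN⟩ := exists_nat_ge (-t)
  refine IsGaussianFunctional.of_tendsto hX.measurable (Y := fun n ω =>
    stieltjes (fun s => Real.exp (-(lam * (t - s)))) (fun s => X s ω) (-((n + N : ℕ) : ℝ)) t)
    (fun n => ?_) ?_
  · have hle : -((n + N : ℕ) : ℝ) ≤ t := by push_cast; linarith [Nat.cast_nonneg (α := ℝ) n]
    refine IsGaussianFunctional.of_tendsto hX.measurable
      (fun j => isGaussianFunctional_unifSum hX (fun s => Real.exp (-(lam * (t - s))))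
        (-((n + N : ℕ) : ℝ)) t j) ?_
    filter_upwards [hgood] with ω hω
    have h := hasStieltjes_exp hlam hω.continuous t (-((n + N : ℕ) : ℝ))
    rw [h.stieltjes_eq hle]
    exact h.tendsto_unifSum hle
  · filter_upwards [hgood] with ω hω
    rw [hω.expConv_eq hlam]
    exact (tendsto_add_atTop_iff_nat (f := fun n : ℕ =>
      stieltjes (fun s => Real.exp (-(lam * (t - s)))) (fun s => X s ω) (-(n : ℝ)) t) N).mpr
        (hω.tendsto_stieltjes hlam t)

end GaussianLimits

/-! ### Almost sure properties of fractional Brownian paths -/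

section FBM

variable {Ω : Type*} [MeasurableSpace Ω] {P : Measure Ω} {H : ℝ} {X : ℝ → Ω → ℝ}

/-- The process is set to zero off a measurable set of full measure. Continuity of every path gives
the joint measurability needed for Fubini. -/
lemma IsFBM.exists_continuous_version (hX : IsFBM H X P) :
    ∃ X' : ℝ → Ω → ℝ, IsFBM H X' P ∧ (∀ ω, Continuous fun s => X' s ω) ∧
      ∀ᵐ ω ∂P, ∀ s, X' s ω = X s ω := by
  classical
  obtain ⟨G, hG, hGm, hGc⟩ : ∃ G ∈ ae P, MeasurableSet G ∧
      ∀ ω ∈ G, Continuous fun s => X s ω := by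
    obtain ⟨N, hN, hNm, hN0⟩ := exists_measurable_superset_of_null (ae_iff.mp hX.continuous)
    refine ⟨Nᶜ, compl_mem_ae_iff.mpr hN0, hNm.compl, fun ω hω => ?_⟩
    by_contra hc
    exact hω (hN hc)
  have hae : ∀ᵐ ω ∂P, ∀ s, G.indicator (X s) ω = X s ω := by
    filter_upwards [hG] with ω hω s
    exact indicator_of_mem hω _
  have hae' : ∀ s, G.indicator (X s) =ᵐ[P] X s := fun s => by
    filter_upwards [hae] with ω hω using hω s
  have hcont : ∀ ω, Continuous fun s => G.indicator (X s) ω := fun ω => by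
    by_cases h : ω ∈ G
    · simpa only [indicator_of_mem h] using hGc ω h
    · simpa only [indicator_of_notMem h] using continuous_const
  refine ⟨fun s => G.indicator (X s), ⟨fun s => (hX.measurable s).indicator hGm,
    hX.gaussian.congr fun s => (hae' s).symm, fun s => ?_, fun s r => ?_,
    ae_of_all _ hcont⟩, hcont, hae⟩
  · rw [integral_congr_ae (hae' s), hX.centered]
  · rw [← hX.covariance]
    exact integral_congr_ae ((hae' s).mul (hae' r))

lemma IsFBM.memLp_two (hX : IsFBM H X P) (s : ℝ) : MemLp (X s) 2 P :=
  (hX.gaussian.hasGaussianLaw_eval s).memLp_two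

lemma IsFBM.integral_abs_le [IsProbabilityMeasure P] (hX : IsFBM H X P) (hH : 0 < H) (hH' : H < 1) (s : ℝ) :
    ∫ ω, |X s ω| ∂P ≤ 2 + s ^ 2 := by
  have hsq : ∫ ω, X s ω ^ 2 ∂P = |s| ^ (2 * H) := by
    have := hX.covariance s s
    simp only [← pow_two] at this
    rw [this, sub_self, abs_zero, Real.zero_rpow (by linarith)]
    ring
  have hpow : |s| ^ (2 * H) ≤ 1 + s ^ 2 := by
    rcases le_total |s| 1 with h | h
    · have := Real.rpow_le_one (abs_nonneg s) h (by linarith : 0 ≤ 2 * H)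
      nlinarith [sq_nonneg s]
    · have := Real.rpow_le_rpow_of_exponent_le h (by linarith : 2 * H ≤ 2)
      rw [Real.rpow_two, sq_abs] at this
      linarith
  have hint : Integrable (fun ω => 1 + X s ω ^ 2) P :=
    (integrable_const _).add (hX.memLp_two s).integrable_sq
  calc ∫ ω, |X s ω| ∂P ≤ ∫ ω, (1 + X s ω ^ 2) ∂P := by
        refine integral_mono ((hX.memLp_two s).integrable (by norm_num)).abs hint fun ω => ?_
        have := sq_abs (X s ω)
        have h2 := sq_nonneg (|X s ω| - 1)
        simp only
        nlinarith [abs_nonneg (X s ω)]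
    _ = 1 + |s| ^ (2 * H) := by
        rw [integral_add (integrable_const _) (hX.memLp_two s).integrable_sq, hsq]; simp
    _ ≤ _ := by linarith

lemma integrableOn_exp_mul_abs_rpow {lam : ℝ} (hlam : 0 < lam) {p : ℝ} (hp : 0 ≤ p) :
    IntegrableOn (fun r => lam * Real.exp (-(lam * r)) * |r| ^ p) (Ioi 0) := by
  have h := (integrableOn_rpow_mul_exp_neg_mul_rpow (p := 1) (s := p) (by linarith) one_pos
    hlam).const_mul lam
  refine IntegrableOn.congr_fun h (fun r hr => ?_) measurableSet_Ioi
  simp only [Real.rpow_one, abs_of_pos (mem_Ioi.mp hr), neg_mul]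
  ring

lemma measurable_uncurry_path (hm : ∀ s, Measurable (X s)) (hc : ∀ ω, Continuous fun s => X s ω) :
    Measurable fun p : ℝ × Ω => X p.1 p.2 :=
  measurable_uncurry_of_continuous_of_measurable hc hm

/-- The bound E|X_s| ≤ 2 + s² is beaten by the exponential weight, both in the integral over s ≤ 0
and in the sum over integers; Fubini and Tonelli make the two conditions almost sure. -/
lemma IsFBM.goodPath_ae_of_continuous [IsProbabilityMeasure P] (hX : IsFBM H X P) (hH : 0 < H) (hH' : H < 1)
    (hc : ∀ ω, Continuous fun s => X s ω) {lam : ℝ} (hlam : 0 < lam) :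
    ∀ᵐ ω ∂P, GoodPath lam fun s => X s ω := by
  have hjm := measurable_uncurry_path hX.measurable hc
  have hint1 : ∀ s, Integrable (X s) P := fun s => (hX.memLp_two s).integrable (by norm_num)
  have h1 : ∀ᵐ ω ∂P, IntegrableOn (fun s => Real.exp (lam * s) * X s ω) (Iic 0) := by
    have hF : Integrable (fun q : Ω × ℝ => Real.exp (lam * q.2) * X q.2 q.1)
        (P.prod (volume.restrict (Iic 0))) := by
      have hmeas : Measurable fun q : Ω × ℝ => Real.exp (lam * q.2) * X q.2 q.1 :=
        (by fun_prop : Measurable fun q : Ω × ℝ => Real.exp (lam * q.2)).mul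
          (hjm.comp measurable_swap)
      rw [integrable_prod_iff' hmeas.aestronglyMeasurable]
      refine ⟨ae_of_all _ fun s => (hint1 s).const_mul (Real.exp (lam * s)), ?_⟩
      have hdom : IntegrableOn (fun s => Real.exp (lam * s) * (2 + s ^ 2)) (Iic 0) := by
        rw [integrableOn_Iic_iff_Ioi]
        have a := integrableOn_exp_mul_abs_rpow hlam (p := 0) le_rfl
        have b := integrableOn_exp_mul_abs_rpow hlam (p := 2) (by norm_num)
        refine ((a.const_mul (2 / lam)).add (b.const_mul (1 / lam))).congr (ae_of_all _ fun r => ?_)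
        simp only [Pi.add_apply, Real.rpow_zero, Real.rpow_two, sq_abs]
        rw [show lam * (0 - r) = -(lam * r) by ring]
        field_simp
        ring
      refine hdom.mono' ?_ (ae_of_all _ fun s => ?_)
      · exact hmeas.norm.stronglyMeasurable.integral_prod_left'
          |>.aestronglyMeasurable
      · rw [Real.norm_of_nonneg (integral_nonneg fun _ => norm_nonneg _)]
        simp only [norm_mul, Real.norm_eq_abs, Real.abs_exp]
        rw [integral_const_mul]
        exact mul_le_mul_of_nonneg_left (hX.integral_abs_le hH hH' s) (Real.exp_pos _).le
    exact hF.prod_right_ae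
  have h2 : ∀ᵐ ω ∂P,
      Tendsto (fun n : ℕ => Real.exp (-(lam * n)) * X (-(n : ℝ)) ω) atTop (𝓝 0) := by
    have hmeas : ∀ n : ℕ, Measurable fun ω => ‖Real.exp (-(lam * n)) * X (-(n : ℝ)) ω‖ₑ :=
      fun n => ((hX.measurable _).const_mul _).enorm
    have hsum : Summable fun n : ℕ => Real.exp (-(lam * n)) * (2 + (n : ℝ) ^ 2) := by
      have a := Real.summable_pow_mul_exp_neg_nat_mul 0 hlam
      have b := Real.summable_pow_mul_exp_neg_nat_mul 2 hlam
      refine ((a.mul_left 2).add b).congr fun n => ?_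
      simp only [pow_zero, neg_mul]
      ring
    have hfin : ∫⁻ ω, ∑' n : ℕ, ‖Real.exp (-(lam * n)) * X (-(n : ℝ)) ω‖ₑ ∂P ≠ ∞ := by
      rw [lintegral_tsum fun n => (hmeas n).aemeasurable]
      refine ne_top_of_le_ne_top hsum.tsum_ofReal_ne_top (ENNReal.tsum_le_tsum fun n => ?_)
      have hi : Integrable (fun ω => Real.exp (-(lam * n)) * X (-(n : ℝ)) ω) P :=
        (hint1 _).const_mul _
      rw [← ofReal_integral_norm_eq_lintegral_enorm hi]
      refine ENNReal.ofReal_le_ofReal ?_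
      simp only [norm_mul, Real.norm_eq_abs, Real.abs_exp]
      rw [integral_const_mul]
      refine mul_le_mul_of_nonneg_left ?_ (Real.exp_pos _).le
      simpa using hX.integral_abs_le hH hH' (-(n : ℝ))
    filter_upwards [ae_lt_top (Measurable.tsum hmeas) hfin] with ω hω
    have := ENNReal.tendsto_atTop_zero_of_tsum_ne_top hω.ne
    rw [tendsto_iff_edist_tendsto_0]
    simpa only [edist_zero_right] using this
  filter_upwards [h1, h2] with ω a b using ⟨hc ω, a, b⟩

lemma IsFBM.integral_increment_mul (hX : IsFBM H X P) (t r s : ℝ) :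
    ∫ ω, (X t ω - X (t - r) ω) * (X t ω - X (t - s) ω) ∂P =
      (|r| ^ (2 * H) + |s| ^ (2 * H) - |r - s| ^ (2 * H)) / 2 - |(0 : ℝ)| ^ (2 * H) / 2 := by
  have hm : ∀ a b, Integrable (fun ω => X a ω * X b ω) P := fun a b =>
    (hX.memLp_two a).integrable_mul (hX.memLp_two b)
  have e : ∀ ω, (X t ω - X (t - r) ω) * (X t ω - X (t - s) ω) =
      X t ω * X t ω - X t ω * X (t - s) ω - (X (t - r) ω * X t ω - X (t - r) ω * X (t - s) ω) :=
    fun ω => by ring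
  simp only [e]
  have hs : ∀ a b a' b', Integrable (fun ω => X a ω * X b ω - X a' ω * X b' ω) P :=
    fun a b a' b' => (hm a b).sub (hm a' b')
  rw [integral_sub (hs _ _ _ _) (hs _ _ _ _), integral_sub (hm _ _) (hm _ _),
    integral_sub (hm _ _) (hm _ _)]
  simp only [hX.covariance]
  rw [show t - (t - s) = s by ring, show t - r - t = -r by ring,
    show t - r - (t - s) = -(r - s) by ring, abs_neg, abs_neg, sub_self]
  ring

/-- The covariance `(r^{2H} + s^{2H} - |r-s|^{2H}) / 2` of fractional Brownian motion. -/
def fbmCov (H r s : ℝ) : ℝ := (|r| ^ (2 * H) + |s| ^ (2 * H) - |r - s| ^ (2 * H)) / 2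

lemma fbmCov_mul {lam : ℝ} (hlam : 0 < lam) (r s : ℝ) :
    fbmCov H (lam * r) (lam * s) = lam ^ (2 * H) * fbmCov H r s := by
  simp only [fbmCov, ← mul_sub, abs_mul, abs_of_pos hlam]
  rw [Real.mul_rpow hlam.le (abs_nonneg _), Real.mul_rpow hlam.le (abs_nonneg _),
    Real.mul_rpow hlam.le (abs_nonneg _)]
  ring

/-- The substitution r ↦ λr, s ↦ λs and the self-similarity of the covariance produce λ^{-2H}. -/
lemma integral_exp_fbmCov {lam : ℝ} (hlam : 0 < lam) :
    ∫ r in Ioi (0 : ℝ), ∫ s in Ioi (0 : ℝ),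
      (lam * Real.exp (-(lam * r))) * (lam * Real.exp (-(lam * s))) * fbmCov H r s =
    constC H / lam ^ (2 * H) := by
  set Φ : ℝ → ℝ → ℝ := fun r s => Real.exp (-r) * Real.exp (-s) * fbmCov H r s with hΦ
  have hC : constC H = ∫ r in Ioi (0 : ℝ), ∫ s in Ioi (0 : ℝ), Φ r s := by
    refine setIntegral_congr_fun measurableSet_Ioi fun r hr => ?_
    refine setIntegral_congr_fun measurableSet_Ioi fun s hs => ?_
    simp only [hΦ, fbmCov, abs_of_pos (mem_Ioi.mp hr), abs_of_pos (mem_Ioi.mp hs)]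
  have hpos : 0 < lam ^ (2 * H) := Real.rpow_pos_of_pos hlam _
  have e : ∀ r s, (lam * Real.exp (-(lam * r))) * (lam * Real.exp (-(lam * s))) * fbmCov H r s =
      lam ^ 2 / lam ^ (2 * H) * Φ (lam * r) (lam * s) := fun r s => by
    simp only [hΦ, fbmCov_mul hlam]
    field_simp
  simp only [e, integral_const_mul]
  have inner : ∀ r, ∫ s in Ioi (0 : ℝ), Φ (lam * r) (lam * s) =
      lam⁻¹ * ∫ s in Ioi (0 : ℝ), Φ (lam * r) s := fun r => by
    rw [integral_comp_mul_left_Ioi (fun s => Φ (lam * r) s) 0 hlam, mul_zero, smul_eq_mul]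
  simp only [inner, integral_const_mul]
  rw [integral_comp_mul_left_Ioi (fun r => ∫ s in Ioi (0 : ℝ), Φ r s) 0 hlam, mul_zero, smul_eq_mul,
    hC]
  field_simp

/-- The square is a double integral of increments; Fubini replaces their product by its covariance.
Absolute integrability follows from |ab| ≤ a² + b² and E(X_t - X_{t-r})² = |r|^{2H}. -/
lemma IsFBM.integral_partsConv_sq [IsProbabilityMeasure P] (hX : IsFBM H X P) (hH : 0 < H) (hH' : H < 1)
    (hc : ∀ ω, Continuous fun s => X s ω) {lam : ℝ} (hlam : 0 < lam) (t : ℝ) :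
    ∫ ω, partsConv lam (fun s => X s ω) t ^ 2 ∂P = constC H / lam ^ (2 * H) := by
  set ν : Measure ℝ := volume.restrict (Ioi 0) with hν
  set w : ℝ → ℝ := fun r => lam * Real.exp (-(lam * r)) with hw
  have hw0 : ∀ r, 0 ≤ w r := fun r => by simp only [hw]; positivity
  have hjm := measurable_uncurry_path hX.measurable hc
  set D : ℝ → Ω → ℝ := fun r ω => X t ω - X (t - r) ω with hD
  have hDm : Measurable fun p : ℝ × Ω => D p.1 p.2 :=
    ((hX.measurable t).comp measurable_snd).sub
      (hjm.comp ((measurable_const.sub measurable_fst).prodMk measurable_snd))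
  have hDL : ∀ r, MemLp (D r) 2 P := fun r => (hX.memLp_two t).sub (hX.memLp_two (t - r))
  have hcov : ∀ r s, ∫ ω, D r ω * D s ω ∂P = fbmCov H r s := fun r s => by
    rw [hX.integral_increment_mul t r s, abs_zero, Real.zero_rpow (by linarith), fbmCov]
    ring
  have hDsq : ∀ r, ∫ ω, D r ω ^ 2 ∂P = |r| ^ (2 * H) := fun r => by
    have := hcov r r
    simp only [← pow_two] at this
    rw [this, fbmCov, sub_self, abs_zero, Real.zero_rpow (by linarith)]
    ring
  set G : Ω × (ℝ × ℝ) → ℝ := fun q => (w q.2.1 * D q.2.1 q.1) * (w q.2.2 * D q.2.2 q.1) with hG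
  have hwm : Measurable w := by simp only [hw]; fun_prop
  have hGm : Measurable G := by
    refine Measurable.mul (Measurable.mul ?_ ?_) (Measurable.mul ?_ ?_)
    · exact hwm.comp (measurable_fst.comp measurable_snd)
    · exact hDm.comp ((measurable_fst.comp measurable_snd).prodMk measurable_fst)
    · exact hwm.comp (measurable_snd.comp measurable_snd)
    · exact hDm.comp ((measurable_snd.comp measurable_snd).prodMk measurable_fst)
  have hw1 : Integrable w ν := (integral_exp_weight hlam).1
  have hw2 : Integrable (fun r => w r * |r| ^ (2 * H)) ν :=
    integrableOn_exp_mul_abs_rpow hlam (by linarith)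
  have hGint : Integrable G (P.prod (ν.prod ν)) := by
    rw [integrable_prod_iff' hGm.aestronglyMeasurable]
    have hi : ∀ r s, Integrable (fun ω => (w r * D r ω) * (w s * D s ω)) P := fun r s =>
      ((hDL r).const_mul _).integrable_mul ((hDL s).const_mul _)
    refine ⟨ae_of_all _ fun p => hi p.1 p.2, ?_⟩
    refine ((hw2.mul_prod hw1).add (hw1.mul_prod hw2)).mono' ?_ (ae_of_all _ fun p => ?_)
    · exact hGm.norm.stronglyMeasurable.integral_prod_left'
        |>.aestronglyMeasurable
    · rw [Real.norm_of_nonneg (integral_nonneg fun _ => norm_nonneg _)]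
      have hsq1 := (hDL p.1).integrable_sq
      have hsq2 := (hDL p.2).integrable_sq
      calc ∫ ω, ‖G (ω, p)‖ ∂P ≤ ∫ ω, w p.1 * w p.2 * (D p.1 ω ^ 2 + D p.2 ω ^ 2) ∂P := by
            refine integral_mono (hi p.1 p.2).norm ((hsq1.add hsq2).const_mul _) fun ω => ?_
            simp only [hG, norm_mul, Real.norm_eq_abs, abs_of_nonneg (hw0 _)]
            have h1 : |D p.1 ω| * |D p.2 ω| ≤ D p.1 ω ^ 2 + D p.2 ω ^ 2 := by
              rw [← sq_abs (D p.1 ω), ← sq_abs (D p.2 ω)]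
              nlinarith [sq_nonneg (|D p.1 ω| - |D p.2 ω|), sq_nonneg |D p.1 ω|,
                sq_nonneg |D p.2 ω|]
            have h2 := mul_le_mul_of_nonneg_left h1 (mul_nonneg (hw0 p.1) (hw0 p.2))
            linarith
        _ = _ := by
            rw [integral_const_mul, integral_add hsq1 hsq2, hDsq, hDsq]
            simp only [Pi.add_apply]
            ring
  have hpath : ∀ᵐ ω ∂P, partsConv lam (fun s => X s ω) t ^ 2 = ∫ p, G (ω, p) ∂(ν.prod ν) := by
    filter_upwards [hX.goodPath_ae_of_continuous hH hH' hc hlam] with ω hω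
    rw [hω.partsConv_eq hlam, pow_two]
    exact (integral_prod_mul (μ := ν) (ν := ν) (fun r => w r * D r ω) (fun s => w s * D s ω)).symm
  rw [integral_congr_ae hpath, integral_integral_swap hGint]
  have hinner : ∀ p : ℝ × ℝ, ∫ ω, G (ω, p) ∂P = w p.1 * w p.2 * fbmCov H p.1 p.2 := fun p => by
    rw [← hcov, ← integral_const_mul]
    refine integral_congr_ae (ae_of_all _ fun ω => ?_)
    simp only [hG]
    ring
  have hint2 := hGint.integral_prod_right
  simp only [hinner] at hint2 ⊢
  rw [integral_prod _ hint2]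
  exact integral_exp_fbmCov hlam

/-- The law of the stationary Ornstein–Uhlenbeck type process. -/
lemma IsFBM.expConv_law [IsProbabilityMeasure P] (hX : IsFBM H X P) (hH : 0 < H) (hH' : H < 1) {lam : ℝ} (hlam : 0 < lam)
    (t : ℝ) :
    IsGaussianFunctional X P (fun ω => expConv lam (fun s => X s ω) t) ∧
      P.map (fun ω => expConv lam (fun s => X s ω) t) =
        gaussianReal 0 (constC H / lam ^ (2 * H)).toNNReal := by
  obtain ⟨X', hX', hc, hae⟩ := hX.exists_continuous_version
  have hgood' := hX'.goodPath_ae_of_continuous hH hH' hc hlam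
  have hfun : ∀ᵐ ω ∂P, (fun s => X' s ω) = fun s => X s ω := by
    filter_upwards [hae] with ω hω using funext hω
  have hgood : ∀ᵐ ω ∂P, GoodPath lam fun s => X s ω := by
    filter_upwards [hgood', hfun] with ω h1 h2
    rwa [h2] at h1
  have hY := isGaussianFunctional_expConv (t := t) hlam.le hX hgood
  refine ⟨hY, ?_⟩
  obtain ⟨v, hv⟩ := hY.law
  have hsq : ∫ ω, expConv lam (fun s => X s ω) t ^ 2 ∂P = constC H / lam ^ (2 * H) := by
    rw [← hX'.integral_partsConv_sq hH hH' hc hlam t]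
    refine integral_congr_ae ?_
    filter_upwards [hgood, hfun] with ω h1 h2
    rw [h1.expConv_eq hlam.le, h2]
  have hvar : ∫ ω, expConv lam (fun s => X s ω) t ^ 2 ∂P = v := by
    have h1 : ∫ x, x ^ 2 ∂(P.map fun ω => expConv lam (fun s => X s ω) t) =
        ∫ ω, expConv lam (fun s => X s ω) t ^ 2 ∂P :=
      integral_map (hY.aemeasurable hX.measurable) (by fun_prop)
    rw [← h1, hv]
    have h2 := variance_fun_id_gaussianReal (μ := 0) (v := v)
    rwa [variance_of_integral_eq_zero (by fun_prop) integral_id_gaussianReal] at h2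
  rw [hv, ← hsq, hvar, Real.toNNReal_coe]

end FBM

/-! ### The stationary Stokes process -/

/-- The real (`p.2 = 0`) and imaginary (`p.2 = 1`) parts of the driving processes. -/
def realPath {Ω : Type*} (b : halfLattice → ℝ → Ω → ℂ) (p : halfLattice × Fin 2) (s : ℝ) (ω : Ω) : ℝ :=
  part p.2 (b p.1 s ω)

lemma stokes_eq_assemble {Ω : Type*} (b : halfLattice → ℝ → Ω → ℂ) (t : ℝ) (ω : Ω) :
    stokes b t ω =
      assemble fun p => expConv (len p.1 ^ 2) (fun s => realPath b p s ω) t := by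
  simp [stokes, assemble, realPath, part]

section Stokes

variable {Ω : Type*} [MeasurableSpace Ω] {P : Measure Ω} {H : ℝ}
  {b : halfLattice → ℝ → Ω → ℂ}

lemma IsCylFBM.isFBM_realPath (hb : IsCylFBM H b P) (p : halfLattice × Fin 2) :
    IsFBM H (realPath b p) P := by
  obtain ⟨k, i⟩ := p
  fin_cases i
  · exact hb.re k
  · exact hb.im k

lemma IsCylFBM.iIndepFun_realPath (hb : IsCylFBM H b P) :
    iIndepFun (fun p ω s => realPath b p s ω) P := by
  let g : halfLattice × Fin 2 → halfLattice ⊕ halfLattice :=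
    fun p => if p.2 = 0 then Sum.inl p.1 else Sum.inr p.1
  have hg : Function.Injective g := by
    rintro ⟨k, i⟩ ⟨l, j⟩ h
    fin_cases i <;> fin_cases j <;> simp [g] at h ⊢ <;> exact h
  have h := hb.indep.precomp hg
  have e : (fun p ω s => realPath b p s ω) = fun p =>
      Sum.elim (fun (k : halfLattice) (ω : Ω) (t : ℝ) => (b k t ω).re)
        (fun (k : halfLattice) (ω : Ω) (t : ℝ) => (b k t ω).im) (g p) := by
    funext ⟨k, i⟩
    fin_cases i <;> rfl
  rw [e]
  exact h

lemma len_sq_pos (k : halfLattice) : 0 < len k ^ 2 := by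
  have := len_pos (halfLattice_ne_zero k)
  positivity

lemma varH_eq (H : ℝ) (k : ℤ × ℤ) : (constC H / (len k ^ 2) ^ (2 * H)).toNNReal = varH H k := by
  rw [varH, ← Real.rpow_two, ← Real.rpow_mul (len_nonneg k)]
  congr 3
  ring

/-- Each real coordinate has the right Gaussian law, and the coordinates are independent as
functionals of independent paths, so together they have law `gaussFam H`. -/
lemma IsCylFBM.stokes_law [IsProbabilityMeasure P] (hb : IsCylFBM H b P) (hH : 0 < H)
    (hH' : H < 1) (t : ℝ) :
    AEMeasurable (stokes b t) P ∧ P.map (stokes b t) = muH H := by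
  set Y : halfLattice × Fin 2 → Ω → ℝ :=
    fun p ω => expConv (len p.1 ^ 2) (fun s => realPath b p s ω) t with hY
  have hlaw := fun p : halfLattice × Fin 2 =>
    (hb.isFBM_realPath p).expConv_law hH hH' (len_sq_pos p.1) t
  have hm : ∀ p, AEMeasurable (Y p) P := fun p =>
    (hlaw p).1.aemeasurable (hb.isFBM_realPath p).measurable
  have hind : iIndepFun Y P := by
    choose Φ hΦ e using fun p => (hlaw p).1.functional
    exact (hb.iIndepFun_realPath.comp Φ hΦ).congr fun p => (e p).symm
  have hmap : P.map (fun ω p => Y p ω) = gaussFam H := by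
    rw [hind.map_fun_eq_infinitePi_map₀' hm, gaussFam]
    congr 1
    ext1 p
    rw [← varH_eq]
    exact (hlaw p).2
  have hYm : AEMeasurable (fun ω p => Y p ω) P := aemeasurable_pi_lambda _ hm
  have e : stokes b t = assemble ∘ fun ω p => Y p ω := funext fun ω => stokes_eq_assemble b t ω
  rw [e]
  refine ⟨measurable_assemble.comp_aemeasurable hYm, ?_⟩
  rw [← AEMeasurable.map_map_of_aemeasurable measurable_assemble.aemeasurable hYm, hmap, muH_eq]

lemma measurable_partsConv {X : ℝ → Ω → ℝ} (hm : ∀ s, Measurable (X s))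
    (hc : ∀ ω, Continuous fun s => X s ω) (lam : ℝ) :
    Measurable fun q : Ω × ℝ => partsConv lam (fun s => X s q.1) q.2 := by
  have hjm := measurable_uncurry_path hm hc
  have h1 : Measurable fun x : (Ω × ℝ) × ℝ =>
      (Iic x.1.2).indicator (fun s => lam * Real.exp (-(lam * (x.1.2 - s))) * X s x.1.1) x.2 := by
    have hset : MeasurableSet {x : (Ω × ℝ) × ℝ | x.2 ≤ x.1.2} :=
      measurableSet_le measurable_snd (measurable_snd.comp measurable_fst)
    have hF : Measurable fun x : (Ω × ℝ) × ℝ =>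
        lam * Real.exp (-(lam * (x.1.2 - x.2))) * X x.2 x.1.1 :=
      (by fun_prop : Measurable fun x : (Ω × ℝ) × ℝ => lam * Real.exp (-(lam * (x.1.2 - x.2)))).mul
        (hjm.comp (measurable_snd.prodMk (measurable_fst.comp measurable_fst)))
    exact hF.indicator hset
  have h2 := (h1.stronglyMeasurable.integral_prod_right' (ν := volume)).measurable
  simp only [integral_indicator measurableSet_Iic] at h2
  exact (hjm.comp measurable_swap).sub h2

/-- One exceptional null set serves all modes and all t, since there are countably many modes and
integration by parts holds for every t on a good path. -/
lemma IsCylFBM.exists_measurable_version [IsProbabilityMeasure P] (hb : IsCylFBM H b P)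
    (hH : 0 < H) (hH' : H < 1) :
    ∃ Z : Ω × ℝ → Coeff, Measurable Z ∧ ∀ᵐ ω ∂P, ∀ t, stokes b t ω = Z (ω, t) := by
  choose X hX hc hae using fun p => (hb.isFBM_realPath p).exists_continuous_version
  refine ⟨fun q => assemble fun p => partsConv (len p.1 ^ 2) (fun s => X p s q.1) q.2,
    measurable_assemble.comp (measurable_pi_lambda _ fun p =>
      measurable_partsConv (hX p).measurable (hc p) _), ?_⟩
  have hgood := fun p : halfLattice × Fin 2 =>
    (hX p).goodPath_ae_of_continuous hH hH' (hc p) (len_sq_pos p.1)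
  filter_upwards [ae_all_iff.mpr hae, ae_all_iff.mpr hgood] with ω h1 h2 t
  rw [stokes_eq_assemble]
  congr 1
  funext p
  rw [← (h2 p).expConv_eq (len_sq_pos p.1).le]
  congr 1
  funext s
  exact (h1 p s).symm

/-- Every time slice of the preimage of a μ^H-null set is P-null, so Tonelli makes the preimage
null. -/
lemma IsCylFBM.quasiMeasurePreserving [IsProbabilityMeasure P] (hb : IsCylFBM H b P)
    (hH : 0 < H) (hH' : H < 1) {Z : Ω × ℝ → Coeff} (hZ : Measurable Z)
    (hae : ∀ᵐ ω ∂P, ∀ t, stokes b t ω = Z (ω, t)) (ν : Measure ℝ) [SFinite ν] :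
    (∀ t, P.map (fun ω => Z (ω, t)) = muH H) ∧
      Measure.QuasiMeasurePreserving Z (P.prod ν) (muH H) := by
  have hmap : ∀ t, P.map (fun ω => Z (ω, t)) = muH H := fun t => by
    rw [← (hb.stokes_law hH hH' t).2]
    exact Measure.map_congr (by filter_upwards [hae] with ω hω using (hω t).symm)
  refine ⟨hmap, hZ, Measure.AbsolutelyContinuous.mk fun s hs h0 => ?_⟩
  rw [Measure.map_apply hZ hs, Measure.prod_apply_symm (hZ hs)]
  refine (lintegral_congr fun t => ?_).trans lintegral_zero
  have := Measure.map_apply (μ := P) (hZ.comp (measurable_prodMk_right (y := t))) hs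
  rw [show Z ∘ (fun x => (x, t)) = fun ω => Z (ω, t) from rfl, hmap t, h0] at this
  exact this.symm

/-- By Tonelli the expected m-th power of the norm over (0,T) is T times the static moment, hence
finite; the other two claims are μ^H-almost sure properties pulled back to Ω × (0,T). -/
lemma IsCylFBM.stokes_memLpH [IsProbabilityMeasure P] (hb : IsCylFBM H b P) (hH : 1 / 4 < H)
    (hH' : H < 1) {ρ : ℝ} (hρ : H < 1 / 2 → ρ < 4 * H - 3) (hρ' : 1 / 2 ≤ H → ρ < 2 * (H - 1))
    (T : ℝ) {m : ℝ} (hm : 1 ≤ m) :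
    ∀ᵐ ω ∂P, (∀ᵐ t ∂volume.restrict (Ioo 0 T), QuadConverges (stokes b t ω)) ∧
      MemLpH m T ρ (fun t => quadB (stokes b t ω)) := by
  have hH0 : 0 < H := by linarith
  obtain ⟨Z, hZ, hae⟩ := hb.exists_measurable_version hH0 hH'
  set ν : Measure ℝ := volume.restrict (Ioo 0 T) with hν
  obtain ⟨hmap, hqmp⟩ := hb.quasiMeasurePreserving hH0 hH' hZ hae ν
  have hQ := Measure.ae_ae_of_ae_prod (hqmp.ae (quadConverges_ae hH))
  have hM := Measure.ae_ae_of_ae_prod (hqmp.ae (memH_quadB_ae hH hρ hρ'))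
  have hnm : Measurable fun z => normH ρ (quadB z) ^ m :=
    ((measurable_normH ρ).comp measurable_quadB_pi).pow_const _
  have hfin : ∫⁻ ω, ∫⁻ t, normH ρ (quadB (Z (ω, t))) ^ m ∂ν ∂P ≠ ∞ := by
    rw [lintegral_lintegral_swap (f := fun ω t => normH ρ (quadB (Z (ω, t))) ^ m)
      (hnm.comp hZ).aemeasurable]
    have e : ∀ t, ∫⁻ ω, normH ρ (quadB (Z (ω, t))) ^ m ∂P =
        ∫⁻ z, normH ρ (quadB z) ^ m ∂muH H := fun t => by
      have hZt : Measurable fun ω => Z (ω, t) := hZ.comp measurable_prodMk_right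
      rw [← hmap t, lintegral_map hnm hZt]
    simp only [e, lintegral_const]
    refine (ENNReal.mul_lt_top
      (lintegral_normH_quadB_rpow_lt_top hH hρ hρ' (by linarith)) ?_).ne
    simp [hν]
  have hfin' := ae_lt_top ((hnm.comp hZ).lintegral_prod_right') hfin
  filter_upwards [hae, hQ, hM, hfin'] with ω h0 h1 h2 h3
  simp only [h0]
  exact ⟨h1, fun k => ((measurable_quadB k).comp (hZ.comp measurable_prodMk_left)).aemeasurable,
    h2, h3⟩

end Stokes

end

end FracStokes

theorem mainTheorem4 (H ρ : ℝ) (hH : 1 / 4 < H) (hH' : H < 1)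
    (hρ : H < 1 / 2 → ρ < 4 * H - 3) (hρ' : 1 / 2 ≤ H → ρ < 2 * (H - 1)) :
    -- `B(z,z)` is well defined for `μ^H`-almost every `z`, as a Galerkin limit, and each
    -- coefficient is the sum of its Fourier series, unconditionally in `L²(μ^H)`
    (∀ᵐ z ∂FracStokes.muH H, FracStokes.QuadConverges z) ∧
    (∀ k : ℤ × ℤ, Tendsto
      (fun F : Finset {h : ℤ × ℤ // h ≠ 0 ∧ h ≠ k} =>
        eLpNorm (fun z : FracStokes.Coeff =>
          Complex.I * ∑ h ∈ F, (FracStokes.gam h k : ℂ) * z h * z (k - h)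
            - FracStokes.quadB z k) 2 (FracStokes.muH H))
      atTop (𝓝 0)) ∧
    -- `B(z,z)` is an `H^ρ`-valued random variable with finite moments
    (∀ k : ℤ × ℤ, AEMeasurable (fun z => FracStokes.quadB z k) (FracStokes.muH H)) ∧
    (∀ᵐ z ∂FracStokes.muH H, FracStokes.MemH ρ (FracStokes.quadB z)) ∧
    (∀ m : ℕ, ∫⁻ z, FracStokes.normH ρ (FracStokes.quadB z) ^ (2 * m) ∂FracStokes.muH H < ∞) ∧
    -- the stationary Stokes process `z` has law `μ^H`, and `B(z,z) ∈ L^m(0,T;H^ρ)` almost surely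
    (∀ (Ω : Type*) [MeasurableSpace Ω] (P : Measure Ω) [IsProbabilityMeasure P]
      (b : FracStokes.halfLattice → ℝ → Ω → ℂ), FracStokes.IsCylFBM H b P →
      (∀ t : ℝ, AEMeasurable (FracStokes.stokes b t) P ∧
        P.map (FracStokes.stokes b t) = FracStokes.muH H) ∧
      ∀ T : ℝ, 0 < T → ∀ m : ℝ, 1 ≤ m → ∀ᵐ ω ∂P,
        (∀ᵐ t ∂volume.restrict (Ioo 0 T),
          FracStokes.QuadConverges (FracStokes.stokes b t ω)) ∧
        FracStokes.MemLpH m T ρ (fun t => FracStokes.quadB (FracStokes.stokes b t ω))) := by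
  exact ⟨FracStokes.quadConverges_ae hH, fun k => (FracStokes.quadB_converges hH k).2,
    fun k => (FracStokes.measurable_quadB k).aemeasurable, FracStokes.memH_quadB_ae hH hρ hρ',
    fun m => FracStokes.lintegral_normH_quadB_lt_top hH hρ hρ' m,
    fun _ _ _ _ _ hb => ⟨fun t => hb.stokes_law (by linarith) hH' t,
      fun T _ _ hm => hb.stokes_memLpH hH hH' hρ hρ' T hm⟩⟩
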